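/- Let $K=\prod_{i=1}^3(x_i^c-h_i,x_i^c+h_i)$ with all $h_i>0$, let $\mathcal F(K)$ be its six faces, and let $\bm n_f$ be a unit normal vector of the face $f$ (either orientation). For an integer $k$ let $P_k(K)$ and $P_k(f)$ be the polynomials of degree at most $k$ on $K$ and, in the two Cartesian coordinates of $f$, on $f$ (the zero space if $k<0$); $[P_k(f)]^2$ denotes the tangential vector fields on $f$ with both components in $P_k(f)$. Let $r\ge 2$ be an integer. Put $$\mathcal S^2_{r-1}(K)=[P_{r-1}(K)]^3+\operatorname{curl}\{(x_2x_3(w_2-w_3),\,x_1x_3(w_3-w_1),\,x_1x_2(w_1-w_2))^{\mathrm T}\},$$ where each $w_i$ ranges over the homogeneous polynomials of degree $r-1$ that are independent of $x_i$. Put $B_K=\prod_{i=1}^3(x_i-x_i^c+h_i)(x_i^c+h_i-x_i)$ and $B_f=B_K/\lambda_f$, where $\lambda_f$ is the degree-one polynomial that vanishes on $f$ and equals the distance to the plane of $f$ inside $K$. Let $$\mathcal V_f^{r-2}(K)=\Big\{\bm q\in[P_{r-2}(K)]^3\times\bm n_f:\ \int_K \bm q\cdot B_KB_f\bm w\,dV=0\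 \text{ for all } \bm w\in[P_{r-3}(K)]^3\times\bm n_f\Big\},$$ $$\mathcal V^{r-2}(K)=B_K\sum_{f\in\mathcal F(K)}B_f\mathcal V_f^{r-2}(K),\qquad \mathcal S^{+,2}_{r-1}(K)=\mathcal S^2_{r-1}(K)+\operatorname{curl}\mathcal V^{r-2}(K).$$ Then the last sum is direct, and the following degrees of freedom are unisolvent for $\mathcal S^{+,2}_{r-1}(K)$: - $\int_f \bm u\cdot\bm n_f\,q\,dA$ for $q\in P_{r-1}(f)$, $f\in\mathcal F(K)$; - $\int_f (\bm u\times\bm n_f)\cdot\bm q\,dA$ for $\bm q\in[P_{r-2}(f)]^2$, $f\in\mathcal F(K)$; - $\int_K \bm u\cdot\bm q\,dV$ for $\bm q\in[P_{r-3}(K)]^3$. That is, for all linear functionals $a_f$ on $P_{r-1}(f)$ and $b_f$ on $[P_{r-2}(f)]^2$ ($f\in\mathcal F(K)$) and $d$ on $[P_{r-3}(K)]^3$ there is exactly one $\bm u\in\mathcal S^{+,2}_{r-1}(K)$ whose three families of moments are given by $a_f$, $b_f$ and $d$. The number of these degrees of freedom (the sum of the dimensions of the test spaces) equals $$\dim\mathcal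 S^{+,2}_{r-1}(K)=\tfrac12 r(r^2+3r+8)+6r(r-1),$$ which is $30$ for $r=2$. -/

import Mathlib

open MeasureTheory

noncomputable section

namespace StokesFE

/-- Real polynomials in the coordinates `x₁, x₂, x₃` (indexed by `0, 1, 2`). A polynomial function on
a set with non-empty interior is identified with its polynomial. -/
abbrev Poly : Type := MvPolynomial (Fin 3) ℝ

/-- Polynomial vector fields with three components. -/
abbrev VecPoly : Type := Fin 3 → Poly

/-- `P_k`: polynomials of total degree at most `k`; this is the zero space for `k < 0`. -/
def P (k : ℤ) : Submodule ℝ Poly :=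
  MvPolynomial.restrictSupport ℝ {s | (s.degree : ℤ) ≤ k}

/-- `[P_k]³`. -/
def vecP (k : ℤ) : Submodule ℝ VecPoly :=
  Submodule.pi Set.univ fun _ => P k

/-- Homogeneous polynomials of degree `k` that do not involve `x_i`. -/
def homIndep (k : ℤ) (i : Fin 3) : Submodule ℝ Poly :=
  MvPolynomial.restrictSupport ℝ {s | (s.degree : ℤ) = k ∧ s i = 0}

/-- The curl of a polynomial vector field. -/
def curl : VecPoly →ₗ[ℝ] VecPoly where
  toFun u := ![MvPolynomial.pderiv 1 (u 2) - MvPolynomial.pderiv 2 (u 1),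
    MvPolynomial.pderiv 2 (u 0) - MvPolynomial.pderiv 0 (u 2),
    MvPolynomial.pderiv 0 (u 1) - MvPolynomial.pderiv 1 (u 0)]
  map_add' u v := by
    ext1 i; fin_cases i <;> simp <;> ring
  map_smul' a u := by
    ext1 i; fin_cases i <;> simp [smul_sub]

/-- A constant vector, regarded as a polynomial vector field. -/
def constVec (n : Fin 3 → ℝ) : VecPoly := fun i => MvPolynomial.C (n i)

/-- `u ↦ u × n` for a constant vector `n`. -/
def crossConst (n : Fin 3 → ℝ) : VecPoly →ₗ[ℝ] VecPoly :=
  ((crossProduct (R := Poly)).flip (constVec n)).restrictScalars ℝ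

/-- `u ↦ p u` for a scalar polynomial `p`. -/
def mulBy (p : Poly) : VecPoly →ₗ[ℝ] VecPoly :=
  (LinearMap.lsmul Poly VecPoly p).restrictScalars ℝ

/-- The map `(w₁, w₂, w₃) ↦ (x₂x₃(w₂ - w₃), x₁x₃(w₃ - w₁), x₁x₂(w₁ - w₂))`. -/
def serendipityField : VecPoly →ₗ[ℝ] VecPoly where
  toFun w := ![MvPolynomial.X 1 * MvPolynomial.X 2 * (w 1 - w 2),
    MvPolynomial.X 0 * MvPolynomial.X 2 * (w 2 - w 0),
    MvPolynomial.X 0 * MvPolynomial.X 1 * (w 0 - w 1)]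
  map_add' u v := by
    ext1 i; fin_cases i <;> simp <;> ring
  map_smul' a u := by
    ext1 i; fin_cases i <;> simp [mul_sub, smul_sub]

/-- The `H(div)` serendipity shape space `S²_k = [P_k]³ + curl {serendipityField w}`, where `w_i` is
homogeneous of degree `k` and independent of `x_i`. -/
def S2 (k : ℤ) : Submodule ℝ VecPoly :=
  vecP k ⊔
    ((Submodule.pi Set.univ fun i => homIndep k i).map serendipityField).map curl

/-- An axis-parallel open box `∏ᵢ (cᵢ - hᵢ, cᵢ + hᵢ)` in `ℝ³`, with all `hᵢ > 0`. -/
structure Cube where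
  c : Fin 3 → ℝ
  h : Fin 3 → ℝ
  h_pos : ∀ i, 0 < h i

/-- The six faces of a box: `(i, true)` lies in the plane `x_i = c_i + h_i` and `(i, false)` lies in
the plane `x_i = c_i - h_i`. -/
abbrev Face : Type := Fin 3 × Bool

/-- The outward unit normal vector of a face. -/
def outwardNormal (f : Face) : Fin 3 → ℝ := Pi.single f.1 (if f.2 then 1 else -1)

namespace Cube

/-- The box as a set of points. -/
def toSet (K : Cube) : Set (Fin 3 → ℝ) :=
  Set.univ.pi fun i => Set.Ioo (K.c i - K.h i) (K.c i + K.h i)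

/-- The constant value of the coordinate `x_{f.1}` on the face `f`. -/
def facePos (K : Cube) (f : Face) : ℝ :=
  if f.2 then K.c f.1 + K.h f.1 else K.c f.1 - K.h f.1

/-- The linear function that vanishes on `f` and is the distance to the plane of `f` inside the
box. -/
def lam (K : Cube) (f : Face) : Poly :=
  if f.2 then MvPolynomial.C (K.c f.1 + K.h f.1) - MvPolynomial.X f.1
  else MvPolynomial.X f.1 - MvPolynomial.C (K.c f.1 - K.h f.1)

/-- The bubble `B_K = ∏ᵢ (xᵢ - cᵢ + hᵢ) (cᵢ + hᵢ - xᵢ)`. -/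
def bubble (K : Cube) : Poly :=
  ∏ i : Fin 3, (MvPolynomial.X i - MvPolynomial.C (K.c i) + MvPolynomial.C (K.h i)) *
    (MvPolynomial.C (K.c i) + MvPolynomial.C (K.h i) - MvPolynomial.X i)

/-- The face bubble `B_f = B_K / λ_f`, see `lam_mul_faceBubble`. -/
def faceBubble (K : Cube) (f : Face) : Poly :=
  ∏ g ∈ Finset.univ.erase f, K.lam g

theorem lam_mul_faceBubble (K : Cube) (f : Face) : K.lam f * K.faceBubble f = K.bubble := by
  unfold faceBubble bubble
  rw [Finset.mul_prod_erase _ _ (Finset.mem_univ f), Fintype.prod_prod_type]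
  refine Finset.prod_congr rfl fun i _ => ?_
  simp [lam]
  ring

/-- The `L²` inner product `(u, q)_K = ∫_K u · q dV`. -/
def inner (K : Cube) (u q : VecPoly) : ℝ :=
  ∫ x in K.toSet, MvPolynomial.eval x (u ⬝ᵥ q)

/-- The surface integral `∫_f p dA` over a face `f`, in the two Cartesian coordinates of the face. -/
def faceIntegral (K : Cube) (f : Face) (p : Poly) : ℝ :=
  ∫ y in Set.Icc (fun j : Fin 2 => K.c (f.1.succAbove j) - K.h (f.1.succAbove j))
      (fun j : Fin 2 => K.c (f.1.succAbove j) + K.h (f.1.succAbove j)),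
    MvPolynomial.eval (f.1.insertNth (α := fun _ => ℝ) (K.facePos f) y) p

/-- The space `V_f^k(K)` of all `q ∈ [P_k]³ × n_f` with `(q, B_K B_f w)_K = 0` for all
`w ∈ [P_{k-1}]³ × n_f`. Replacing `n_f` by `-n_f` does not change it. -/
def faceV (K : Cube) (k : ℤ) (f : Face) : Submodule ℝ VecPoly where
  carrier := {q | q ∈ (vecP k).map (crossConst (outwardNormal f)) ∧
    ∀ w ∈ (vecP (k - 1)).map (crossConst (outwardNormal f)),
      K.inner q (mulBy (K.bubble * K.faceBubble f) w) = 0}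
  zero_mem' := ⟨Submodule.zero_mem _, fun w _ => by simp [inner]⟩
  add_mem' := by
    rintro a b ⟨ha, ha'⟩ ⟨hb, hb'⟩
    refine ⟨Submodule.add_mem _ ha hb, fun w hw => ?_⟩
    have hint : ∀ p : Poly, IntegrableOn (fun x => MvPolynomial.eval x p) K.toSet := by
      intro p
      have hc : Continuous fun x : Fin 3 → ℝ => MvPolynomial.eval x p :=
        MvPolynomial.continuous_eval p
      refine (hc.continuousOn.integrableOn_compact (isCompact_univ_pi fun i =>
        isCompact_Icc (a := K.c i - K.h i) (b := K.c i + K.h i))).mono_set ?_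
      exact Set.pi_mono fun i _ => Set.Ioo_subset_Icc_self
    have h1 := ha' w hw
    have h2 := hb' w hw
    unfold inner at h1 h2 ⊢
    simp only [add_dotProduct, map_add]
    rw [integral_add (hint _) (hint _), h1, h2, add_zero]
  smul_mem' := by
    rintro t a ⟨ha, ha'⟩
    refine ⟨Submodule.smul_mem _ t ha, fun w hw => ?_⟩
    have h1 := ha' w hw
    unfold inner at h1 ⊢
    simp only [smul_dotProduct, MvPolynomial.smul_eval]
    rw [integral_const_mul, h1, mul_zero]

/-- The bubble space `V^k(K) = B_K ∑_f B_f V_f^k(K)`. -/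
def bubbleV (K : Cube) (k : ℤ) : Submodule ℝ VecPoly :=
  (⨆ f : Face, (K.faceV k f).map (mulBy (K.faceBubble f))).map (mulBy K.bubble)

/-- `U^k(K) = curl V^k(K)`. -/
def bubbleU (K : Cube) (k : ℤ) : Submodule ℝ VecPoly :=
  (K.bubbleV k).map curl

/-- The enriched shape space `S^{+,2}_{r-1}(K) = S²_{r-1}(K) + curl V^{r-2}(K)`, indexed by `r`. -/
def S2plus (K : Cube) (r : ℕ) : Submodule ℝ VecPoly :=
  S2 ((r : ℤ) - 1) ⊔ K.bubbleU ((r : ℤ) - 2)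

end Cube

/-- `P_k(f)`: polynomials of degree at most `k` in the two Cartesian coordinates of the face `f`. -/
def faceP (f : Face) (k : ℤ) : Submodule ℝ Poly :=
  MvPolynomial.restrictSupport ℝ {s | (s.degree : ℤ) ≤ k ∧ s f.1 = 0}

/-- `[P_k(f)]²`: tangential vector fields on the face `f` whose two tangential components belong to
`P_k(f)`. -/
def faceVecP (f : Face) (k : ℤ) : Submodule ℝ VecPoly :=
  Submodule.pi Set.univ fun j => if j = f.1 then ⊥ else faceP f k

/-- The face normal moment `∫_f (u · n) q dA`. -/
def normalMoment (K : Cube) (f : Face) (n : Fin 3 → ℝ) (u : VecPoly) (q : Poly) : ℝ :=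
  K.faceIntegral f ((u ⬝ᵥ constVec n) * q)

/-- The face tangential moment `∫_f (u × n) · q dA`. -/
def tangentialMoment (K : Cube) (f : Face) (n : Fin 3 → ℝ) (u q : VecPoly) : ℝ :=
  K.faceIntegral f (crossConst n u ⬝ᵥ q)

/-- The interior moment `∫_K u · q dV`. -/
def interiorMoment (K : Cube) (u q : VecPoly) : ℝ := K.inner u q

end StokesFE

end

/-!
The degrees of freedom separate the two summands of the enriched space.

* The normal and interior moments determine a serendipity field `u = p + curl (serendipityField w)`
  of order `k = r - 1 ≥ 1`. By Euler's identity (`curl_serendipityField`) the components of the curl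
  are `x_i ((k + 3) w_i - ∑ w_j)`, so the normal components have degree `k` on the faces and vanish
  there with their moments. Then `u_i` is divisible by the product of the two distances to the faces
  orthogonal to `x_i`; in top degree, divisibility by `x_i²` gives a linear system for the
  coefficients of `w` that forces `w = 0` (`eq_zero_of_normal_eq_zero`). What remains is
  `u_i = b_i v_i` with `b_i > 0` in the box and `v_i` of degree `k - 2`; testing the interior moments
  with `v` gives `u = 0` (`eq_zero_of_normalMoment_of_inner`).
* The bubbles `curl (B_K B_f q)`, `q ∈ V_f^{r-2}`, have no normal components on the boundary, since
  `B_K = λ_g B_g` and only `∇λ_g = -n_g` contributes on a face `g`; the tangential trace vanishes on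
  `g ≠ f` and is `± B_f² q` on `f` (`faceRestrict_curlBubble`, `tangentialMoment_curlBubble`). Their
  interior moments vanish by integration by parts and the orthogonality in the definition of `V_f`
  (`inner_curlBubble`). Their tangential moments on `f` determine `q`: if these vanish then `q = 0` on
  `f`, so `q = λ_f w`, and orthogonality to `w` reads `∫ B_K² |w|² = 0`
  (`eq_zero_of_tangentialMoment_curlBubble`).

Consequently the degrees of freedom are injective on the parameters `(p, w, (q_f)_f)`
(`Cube.dof_param_injective`). The parameter space has at least as many dimensions as there are
moments, because `V_f^{r-2}` is cut out of a space of dimension `2 (r+1 choose 3)` by at most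
`2 (r choose 3)` equations (`Cube.le_finrank_faceV`). So parameters and degrees of freedom correspond
bijectively; this contains the directness of the sum, unisolvence and the dimension.
-/

noncomputable section

namespace StokesFE

open MvPolynomial

/-! ### Degrees and restriction to a face -/

theorem mem_P {k : ℤ} {p : Poly} :
    p ∈ P k ↔ ∀ s, coeff s p ≠ 0 → (s.degree : ℤ) ≤ k := by
  simp [P, mem_restrictSupport_iff, Set.subset_def]

theorem mem_homIndep {k : ℤ} {i : Fin 3} {p : Poly} :
    p ∈ homIndep k i ↔ ∀ s, coeff s p ≠ 0 → (s.degree : ℤ) = k ∧ s i = 0 := by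
  simp [homIndep, mem_restrictSupport_iff, Set.subset_def]

theorem P_mono {k l : ℤ} (h : k ≤ l) : P k ≤ P l := fun _ hp =>
  mem_P.2 fun s hs => (mem_P.1 hp s hs).trans h

theorem homIndep_le_P (k : ℤ) (i : Fin 3) : homIndep k i ≤ P k := fun _ hp =>
  mem_P.2 fun s hs => (mem_homIndep.1 hp s hs).1.le

theorem mem_P_iff_totalDegree {k : ℤ} {p : Poly} :
    p ∈ P k ↔ p = 0 ∨ (p.totalDegree : ℤ) ≤ k := by
  rw [mem_P]
  constructor
  · intro h
    by_cases hp : p = 0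
    · exact Or.inl hp
    · right
      obtain ⟨s, hs, he⟩ := Finset.exists_mem_eq_sup p.support (support_nonempty.2 hp)
        (fun s => s.sum fun _ e => e)
      have := h s (mem_support_iff.1 hs)
      rw [totalDegree, he]
      exact this
  · rintro (rfl | h) s hs
    · simp at hs
    · refine le_trans ?_ h
      exact_mod_cast le_totalDegree (mem_support_iff.2 hs)

theorem X_mul_mem_P {k : ℤ} {p : Poly} (hp : p ∈ P k) (i : Fin 3) : X i * p ∈ P (k + 1) := by
  rw [mem_P] at hp ⊢
  intro s hs
  rw [coeff_X_mul'] at hs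
  split_ifs at hs with h
  · have h1 := hp _ hs
    have h2 : s = (s - Finsupp.single i 1) + Finsupp.single i 1 :=
      (tsub_add_cancel_of_le (by
        rw [Finsupp.single_le_iff]
        exact Nat.one_le_iff_ne_zero.2 (Finsupp.mem_support_iff.1 h))).symm
    rw [h2, map_add, Finsupp.degree_single]
    push_cast
    linarith
  · exact absurd rfl hs

theorem pderiv_mem_P {k : ℤ} {p : Poly} (hp : p ∈ P k) (i : Fin 3) : pderiv i p ∈ P (k - 1) := by
  rw [mem_P] at hp ⊢
  intro s hs
  rw [coeff_pderiv] at hs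
  have := hp _ (left_ne_zero_of_mul hs)
  rw [map_add, Finsupp.degree_single] at this
  push_cast at this
  linarith

theorem curl_mem_vecP {k : ℤ} {u : VecPoly} (hu : u ∈ vecP k) : curl u ∈ vecP (k - 1) := by
  simp only [vecP, Submodule.mem_pi, Set.mem_univ, forall_const] at hu ⊢
  intro i
  fin_cases i <;>
    exact Submodule.sub_mem _ (pderiv_mem_P (hu _) _) (pderiv_mem_P (hu _) _)

/-- Restriction of a polynomial to the plane of the face `f`, as a polynomial in the two remaining
coordinates: the variable `x_{f.1}` is replaced by its constant value on `f`. -/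
def faceRestrict (K : Cube) (f : Face) : Poly →ₐ[ℝ] Poly :=
  aeval (Function.update X f.1 (C (K.facePos f)))

theorem faceRestrict_X_self (K : Cube) (f : Face) :
    faceRestrict K f (X f.1) = C (K.facePos f) := by
  simp [faceRestrict]

theorem faceRestrict_X_of_ne (K : Cube) (f : Face) {j : Fin 3} (h : j ≠ f.1) :
    faceRestrict K f (X j) = X j := by
  simp [faceRestrict, h]

theorem faceRestrict_C (K : Cube) (f : Face) (a : ℝ) : faceRestrict K f (C a) = C a :=
  algHom_C _ a

theorem eval_faceRestrict (K : Cube) (f : Face) (x : Fin 3 → ℝ) (p : Poly) :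
    eval x (faceRestrict K f p) = eval (Function.update x f.1 (K.facePos f)) p := by
  induction p using MvPolynomial.induction_on with
  | C a => simp
  | add p q hp hq => simp [hp, hq]
  | mul_X p j hp =>
    rw [map_mul, map_mul, map_mul, hp, eval_X]
    by_cases h : j = f.1
    · subst h; simp [faceRestrict_X_self]
    · simp [faceRestrict_X_of_ne K f h, h]

theorem faceRestrict_faceRestrict (K : Cube) (f : Face) (p : Poly) :
    faceRestrict K f (faceRestrict K f p) = faceRestrict K f p :=
  MvPolynomial.funext fun x => by simp [eval_faceRestrict]

theorem faceRestrict_monomial (K : Cube) (f : Face) (s : Fin 3 →₀ ℕ) (a : ℝ) :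
    faceRestrict K f (monomial s a) = monomial (s.erase f.1) (a * K.facePos f ^ s f.1) := by
  refine MvPolynomial.funext fun x => ?_
  rw [eval_faceRestrict, eval_monomial, eval_monomial, mul_assoc]
  congr 1
  rw [Finsupp.prod_fintype _ _ (by simp), Finsupp.prod_fintype _ _ (by simp),
    ← Finset.mul_prod_erase _ _ (Finset.mem_univ f.1),
    ← Finset.mul_prod_erase _ (fun i => x i ^ (s.erase f.1) i) (Finset.mem_univ f.1)]
  simp only [Function.update_self, Finsupp.erase_same, pow_zero, one_mul]
  congr 1
  refine Finset.prod_congr rfl fun j hj => ?_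
  have := Finset.ne_of_mem_erase hj
  simp [this]

theorem faceRestrict_mem_faceP (K : Cube) (f : Face) {k : ℤ} {p : Poly} (hp : p ∈ P k) :
    faceRestrict K f p ∈ faceP f k := by
  rw [← support_sum_monomial_coeff p, map_sum]
  refine Submodule.sum_mem _ fun s hs => ?_
  rw [faceRestrict_monomial, faceP, monomial_mem_restrictSupport]
  left
  refine ⟨?_, by simp⟩
  have h1 := mem_P.1 hp s (mem_support_iff.1 hs)
  have h2 := congrArg Finsupp.degree (Finsupp.single_add_erase f.1 s)
  rw [map_add] at h2
  have : (s.erase f.1).degree ≤ s.degree := by omega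
  exact le_trans (by exact_mod_cast this) h1

theorem lam_ne_zero (K : Cube) (f : Face) : K.lam f ≠ 0 := by
  intro h
  have h1 := congrArg (coeff (Finsupp.single f.1 1)) h
  have h0 : ¬ (0 : Fin 3 →₀ ℕ) = Finsupp.single f.1 1 := by
    intro h; simpa using (congrArg (fun s => s f.1) h)
  unfold Cube.lam at h1
  split_ifs at h1 <;> simp [coeff_C, coeff_X, h0] at h1

theorem faceRestrict_lam_self (K : Cube) (f : Face) : faceRestrict K f (K.lam f) = 0 := by
  unfold Cube.lam
  split_ifs with h <;>
    simp only [map_sub, faceRestrict_X_self, faceRestrict_C, Cube.facePos, h, if_true,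
      sub_self, Bool.false_eq_true, if_false]

theorem faceRestrict_lam_ne_zero (K : Cube) {f g : Face} (hfg : g ≠ f) :
    faceRestrict K f (K.lam g) ≠ 0 := by
  by_cases h : g.1 = f.1
  · obtain ⟨i, a⟩ := f
    obtain ⟨j, b⟩ := g
    obtain rfl : j = i := h
    have hp := K.h_pos j
    have hab : b ≠ a := fun h => hfg (by rw [h])
    intro h0
    have h1 := congrArg (eval 0) h0
    rw [eval_faceRestrict] at h1
    cases a <;> cases b <;> simp [Cube.lam, Cube.facePos] at h1 hab <;> linarith
  · have : faceRestrict K f (K.lam g) = K.lam g := by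
      unfold Cube.lam
      split_ifs <;> simp only [map_sub, faceRestrict_X_of_ne K f h, faceRestrict_C]
    rw [this]
    exact lam_ne_zero K g

theorem lam_dvd_sub_faceRestrict (K : Cube) (f : Face) (p : Poly) :
    K.lam f ∣ p - faceRestrict K f p := by
  have hX : K.lam f ∣ X f.1 - C (K.facePos f) := by
    unfold Cube.lam Cube.facePos
    split_ifs
    · exact ⟨-1, by ring⟩
    · exact dvd_rfl
  induction p using MvPolynomial.induction_on with
  | C a => simp
  | add p q hp hq =>
    rw [map_add, add_sub_add_comm]
    exact dvd_add hp hq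
  | mul_X p j hp =>
    rw [map_mul]
    have hj : K.lam f ∣ X j - faceRestrict K f (X j) := by
      by_cases h : j = f.1
      · subst h; rwa [faceRestrict_X_self]
      · rw [faceRestrict_X_of_ne K f h, sub_self]; exact dvd_zero _
    have : p * X j - faceRestrict K f p * faceRestrict K f (X j) =
        (p - faceRestrict K f p) * X j + faceRestrict K f p * (X j - faceRestrict K f (X j)) := by
      ring
    rw [this]
    exact dvd_add (hp.mul_right _) (hj.mul_left _)

theorem one_le_totalDegree_lam (K : Cube) (f : Face) : 1 ≤ (K.lam f).totalDegree := by
  have h0 : ¬ (0 : Fin 3 →₀ ℕ) = Finsupp.single f.1 1 := by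
    intro h; simpa using (congrArg (fun s => s f.1) h)
  have h1 : Finsupp.single f.1 1 ∈ (K.lam f).support := by
    rw [mem_support_iff]
    unfold Cube.lam
    split_ifs <;> simp [coeff_C, coeff_X, h0]
  simpa using le_totalDegree h1

/-- A polynomial of degree at most `k` that vanishes on the plane of `f` is `lam f` times a
polynomial of degree at most `k - 1`. -/
theorem exists_eq_lam_mul (K : Cube) (f : Face) {k : ℤ} {p : Poly} (hp : p ∈ P k)
    (h0 : faceRestrict K f p = 0) : ∃ q ∈ P (k - 1), p = K.lam f * q := by
  obtain ⟨q, hq⟩ := lam_dvd_sub_faceRestrict K f p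
  rw [h0, sub_zero] at hq
  refine ⟨q, ?_, hq⟩
  by_cases hq0 : q = 0
  · rw [hq0]; exact Submodule.zero_mem _
  · rcases mem_P_iff_totalDegree.1 hp with h | h
    · rw [h] at hq
      exact absurd hq.symm (mul_ne_zero (lam_ne_zero K f) hq0)
    · rw [hq, totalDegree_mul_of_isDomain (lam_ne_zero K f) hq0] at h
      have := one_le_totalDegree_lam K f
      refine mem_P_iff_totalDegree.2 (Or.inr ?_)
      push_cast at h
      have : (1 : ℤ) ≤ (K.lam f).totalDegree := by exact_mod_cast this
      linarith

/-! ### The serendipity space -/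

theorem mem_vecP {k : ℤ} {u : VecPoly} : u ∈ vecP k ↔ ∀ i, u i ∈ P k := by
  simp [vecP]

theorem pderiv_eq_zero_of_mem_homIndep {k : ℤ} {i : Fin 3} {p : Poly} (hp : p ∈ homIndep k i) :
    pderiv i p = 0 := by
  ext m
  rw [coeff_pderiv, coeff_zero]
  by_contra h
  simpa using (mem_homIndep.1 hp _ (left_ne_zero_of_mul h)).2

theorem sum_X_mul_pderiv_of_mem_homIndep {k : ℕ} {i : Fin 3} {p : Poly} (hp : p ∈ homIndep k i) :
    ∑ j, X j * pderiv j p = (k : Poly) * p := by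
  have h : p.IsHomogeneous k := by
    intro s hs
    have := (mem_homIndep.1 hp s hs).1
    have e := congrFun (congrArg DFunLike.coe (Finsupp.degree_eq_weight_one (R := ℕ) (σ := Fin 3))) s
    exact e.symm.trans (by exact_mod_cast this)
  rw [h.sum_X_mul_pderiv, nsmul_eq_mul]

/-- By Euler's identity the components of the supplementary serendipity fields are `x_i` times
homogeneous polynomials of degree `k`. -/
theorem curl_serendipityField {k : ℕ} {w : VecPoly} (hw : ∀ i, w i ∈ homIndep k i) (i : Fin 3) :
    curl (serendipityField w) i = X i * (((k : Poly) + 3) * w i - ∑ j, w j) := by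
  have h0 := sum_X_mul_pderiv_of_mem_homIndep (hw 0)
  have h1 := sum_X_mul_pderiv_of_mem_homIndep (hw 1)
  have h2 := sum_X_mul_pderiv_of_mem_homIndep (hw 2)
  have e0 := pderiv_eq_zero_of_mem_homIndep (hw 0)
  have e1 := pderiv_eq_zero_of_mem_homIndep (hw 1)
  have e2 := pderiv_eq_zero_of_mem_homIndep (hw 2)
  rw [Fin.sum_univ_three] at h0 h1 h2 ⊢
  rw [e0] at h0
  rw [e1] at h1
  rw [e2] at h2
  have d01 : pderiv 0 (X 1 : Poly) = 0 := pderiv_X_of_ne (by decide)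
  have d02 : pderiv 0 (X 2 : Poly) = 0 := pderiv_X_of_ne (by decide)
  have d10 : pderiv 1 (X 0 : Poly) = 0 := pderiv_X_of_ne (by decide)
  have d12 : pderiv 1 (X 2 : Poly) = 0 := pderiv_X_of_ne (by decide)
  have d20 : pderiv 2 (X 0 : Poly) = 0 := pderiv_X_of_ne (by decide)
  have d21 : pderiv 2 (X 1 : Poly) = 0 := pderiv_X_of_ne (by decide)
  fin_cases i
  · simp only [curl, serendipityField, LinearMap.coe_mk, AddHom.coe_mk, Fin.zero_eta,
      Matrix.cons_val, pderiv_mul, map_sub, pderiv_X_self, d10, d12, d20, d21, e1, e2]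
    linear_combination X 0 * h0
  · simp only [curl, serendipityField, LinearMap.coe_mk, AddHom.coe_mk, Fin.mk_one,
      Matrix.cons_val, pderiv_mul, map_sub, pderiv_X_self, d01, d02, d20, d21, e0, e2]
    linear_combination X 1 * h1
  · simp only [curl, serendipityField, LinearMap.coe_mk, AddHom.coe_mk, Fin.reduceFinMk,
      Matrix.cons_val, pderiv_mul, map_sub, pderiv_X_self, d01, d02, d10, d12, e0, e1]
    linear_combination X 2 * h2

theorem exists_curl_serendipityField_eq {k : ℕ} {w : VecPoly} (hw : ∀ i, w i ∈ homIndep k i)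
    (i : Fin 3) : ∃ y ∈ P k, curl (serendipityField w) i = X i * y := by
  refine ⟨_, ?_, curl_serendipityField hw i⟩
  have h : ∀ j, w j ∈ P k := fun j => homIndep_le_P _ _ (hw j)
  refine Submodule.sub_mem _ ?_ (Submodule.sum_mem _ fun j _ => h j)
  have := (P (k : ℤ)).smul_mem ((k : ℝ) + 3) (h i)
  rwa [smul_eq_C_mul, map_add, map_natCast, map_ofNat] at this

/-- On a face the normal component of a field in `S²_k` has degree at most `k`, although the
components have degree `k + 1` in general. -/
theorem faceRestrict_normal_mem_faceP (K : Cube) (f : Face) {k : ℕ} {p w : VecPoly}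
    (hp : p ∈ vecP k) (hw : ∀ i, w i ∈ homIndep k i) :
    faceRestrict K f ((p + curl (serendipityField w)) f.1) ∈ faceP f k := by
  obtain ⟨y, hy, e⟩ := exists_curl_serendipityField_eq hw f.1
  rw [Pi.add_apply, map_add, e, map_mul, faceRestrict_X_self, ← smul_eq_C_mul]
  exact Submodule.add_mem _ (faceRestrict_mem_faceP K f (mem_vecP.1 hp _))
    (Submodule.smul_mem _ _ (faceRestrict_mem_faceP K f hy))

theorem exists_eq_lam_mul_lam (K : Cube) (i : Fin 3) {k : ℤ} {p : Poly} (hp : p ∈ P k)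
    (h0 : ∀ b, faceRestrict K (i, b) p = 0) :
    ∃ q ∈ P (k - 2), p = K.lam (i, true) * K.lam (i, false) * q := by
  obtain ⟨q, hq, rfl⟩ := exists_eq_lam_mul K (i, true) hp (h0 true)
  have h1 := h0 false
  rw [map_mul] at h1
  have h2 := (mul_eq_zero.1 h1).resolve_left (faceRestrict_lam_ne_zero K (by simp))
  obtain ⟨v, hv, rfl⟩ := exists_eq_lam_mul K (i, false) hq h2
  refine ⟨v, ?_, by ring⟩
  rwa [show k - 2 = k - 1 - 1 by ring]

theorem coeff_eq_zero_of_mem_P {k : ℤ} {p : Poly} (hp : p ∈ P k) {s : Fin 3 →₀ ℕ}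
    (hs : k < s.degree) : coeff s p = 0 := by
  by_contra h
  exact absurd (mem_P.1 hp s h) (not_le.2 hs)

/-- The top-degree part of `lam (i, true) * lam (i, false) * q` is divisible by `x_i ^ 2`. -/
theorem coeff_lam_mul_lam_mul (K : Cube) (i : Fin 3) {k : ℤ} {q : Poly} (hq : q ∈ P (k - 1))
    {s : Fin 3 →₀ ℕ} (hs : (s.degree : ℤ) = k) (hi : s i = 0) :
    coeff (s + Finsupp.single i 1) (K.lam (i, true) * K.lam (i, false) * q) = 0 := by
  have e : K.lam (i, true) * K.lam (i, false) * q =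
      C (2 * K.c i) * (X i * q) -
        C ((K.c i + K.h i) * (K.c i - K.h i)) * q - X i * (X i * q) := by
    simp only [Cube.lam, if_true, Bool.false_eq_true, if_false, map_mul, map_add, map_sub,
      map_ofNat]
    ring
  have c0 : coeff s (X i * q) = 0 := by
    rw [coeff_X_mul', if_neg (by simp [hi])]
  rw [e, coeff_sub, coeff_sub, coeff_C_mul, coeff_C_mul, add_comm s, coeff_X_mul, coeff_X_mul,
    c0, coeff_eq_zero_of_mem_P hq (by omega), coeff_eq_zero_of_mem_P hq
      (by rw [map_add, Finsupp.degree_single]; push_cast; omega)]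
  ring

/-- A serendipity field with vanishing normal components on all faces has no supplementary part.
Comparing the coefficients of the monomials of degree `k + 1` that are linear in `x_i` gives, for
the coefficients of each monomial of `w`, a linear system with a dominant diagonal. -/
theorem eq_zero_of_normal_eq_zero (K : Cube) {k : ℕ} (hk : 1 ≤ k) {p w : VecPoly}
    (hp : p ∈ vecP k) (hw : ∀ i, w i ∈ homIndep k i)
    (h0 : ∀ f : Face, faceRestrict K f ((p + curl (serendipityField w)) f.1) = 0) : w = 0 := by
  have key : ∀ (i : Fin 3) (s : Fin 3 →₀ ℕ), s.degree = k → s i = 0 →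
      ((k : ℝ) + 3) * coeff s (w i) = ∑ j, coeff s (w j) := by
    intro i s hs hi
    obtain ⟨y, hy, e⟩ := exists_curl_serendipityField_eq hw i
    have hu : (p + curl (serendipityField w)) i ∈ P (k + 1) := by
      rw [Pi.add_apply, e]
      exact Submodule.add_mem _ (P_mono (by omega) (mem_vecP.1 hp i)) (X_mul_mem_P hy i)
    obtain ⟨q, hq, hq'⟩ := exists_eq_lam_mul_lam K i hu fun b => h0 (i, b)
    have h1 := congrArg (coeff (s + Finsupp.single i 1)) hq'
    rw [coeff_lam_mul_lam_mul K i (k := k) (by convert hq using 2; ring) (by exact_mod_cast hs) hi,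
      Pi.add_apply, coeff_add, coeff_eq_zero_of_mem_P (mem_vecP.1 hp i)
        (by rw [map_add, Finsupp.degree_single]; push_cast; omega),
      curl_serendipityField hw, add_comm s, coeff_X_mul, coeff_sub, coeff_sum] at h1
    have h2 : coeff s (((k : Poly) + 3) * w i) = ((k : ℝ) + 3) * coeff s (w i) := by
      rw [← coeff_C_mul, map_add, map_natCast, map_ofNat]
    rw [h2] at h1
    linarith
  -- the remaining coefficients vanish because `w i` does not involve `x_i`
  have zero : ∀ (i : Fin 3) (s : Fin 3 →₀ ℕ), s i ≠ 0 → coeff s (w i) = 0 := by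
    intro i s hi
    by_contra h
    exact hi (mem_homIndep.1 (hw i) s h).2
  have hk' : (1 : ℝ) ≤ k := by exact_mod_cast hk
  -- `pair` solves the system of a monomial in one variable (two of the `w_i` may contain it),
  -- `single` that of a monomial in two variables
  have pair : ∀ a b : ℝ, ((k : ℝ) + 3) * a = a + b → ((k : ℝ) + 3) * b = a + b →
      a = 0 ∧ b = 0 := by
    intro a b ha hb
    have h1 : ((k : ℝ) + 1) * (a + b) = 0 := by linear_combination ha + hb
    have h2 : a + b = 0 := by
      rcases mul_eq_zero.1 h1 with h | h
      · linarith
      · exact h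
    rw [h2] at ha hb
    have h3 : (k : ℝ) + 3 ≠ 0 := by linarith
    exact ⟨(mul_eq_zero.1 ha).resolve_left h3, (mul_eq_zero.1 hb).resolve_left h3⟩
  have single : ∀ a : ℝ, ((k : ℝ) + 3) * a = a → a = 0 := by
    intro a ha
    have h1 : ((k : ℝ) + 2) * a = 0 := by linear_combination ha
    exact (mul_eq_zero.1 h1).resolve_left (by linarith)
  have all : ∀ s : Fin 3 →₀ ℕ, s.degree = k →
      coeff s (w 0) = 0 ∧ coeff s (w 1) = 0 ∧ coeff s (w 2) = 0 := by
    intro s hs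
    have k0 := key 0 s hs
    have k1 := key 1 s hs
    have k2 := key 2 s hs
    have z0 := zero 0 s
    have z1 := zero 1 s
    have z2 := zero 2 s
    rw [Fin.sum_univ_three] at k0 k1 k2
    rw [Finsupp.degree_eq_sum, Fin.sum_univ_three] at hs
    by_cases s0 : s 0 = 0 <;> by_cases s1 : s 1 = 0 <;> by_cases s2 : s 2 = 0
    · omega
    · have c2 := z2 s2
      have := pair _ _ (by simpa [c2] using k0 s0) (by simpa [c2] using k1 s1)
      exact ⟨this.1, this.2, c2⟩
    · have c1 := z1 s1
      have := pair _ _ (by simpa [c1] using k0 s0) (by simpa [c1] using k2 s2)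
      exact ⟨this.1, c1, this.2⟩
    · have c1 := z1 s1
      have c2 := z2 s2
      exact ⟨single _ (by simpa [c1, c2] using k0 s0), c1, c2⟩
    · have c0 := z0 s0
      have := pair _ _ (by simpa [c0] using k1 s1) (by simpa [c0] using k2 s2)
      exact ⟨c0, this.1, this.2⟩
    · have c0 := z0 s0
      have c2 := z2 s2
      exact ⟨c0, single _ (by simpa [c0, c2] using k1 s1), c2⟩
    · have c0 := z0 s0
      have c1 := z1 s1
      exact ⟨c0, c1, single _ (by simpa [c0, c1] using k2 s2)⟩
    · exact ⟨z0 s0, z1 s1, z2 s2⟩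
  funext i
  ext s
  by_contra h
  have hs := (mem_homIndep.1 (hw i) s h).1
  have := all s (by exact_mod_cast hs)
  fin_cases i
  · exact h this.1
  · exact h this.2.1
  · exact h this.2.2

/-! ### Integrals of polynomials over the box and its faces -/

theorem hasFDerivAt_eval (p : Poly) (x : Fin 3 → ℝ) :
    HasFDerivAt (fun x : Fin 3 → ℝ => eval x p)
      (∑ i, eval x (pderiv i p) • (ContinuousLinearMap.proj i : (Fin 3 → ℝ) →L[ℝ] ℝ)) x := by
  induction p using MvPolynomial.induction_on with
  | C a => simpa using hasFDerivAt_const a x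
  | add p q hp hq =>
    simp only [map_add, add_smul, Finset.sum_add_distrib]
    exact hp.add hq
  | mul_X p j hp =>
    have hj : HasFDerivAt (fun x : Fin 3 → ℝ => x j)
        (ContinuousLinearMap.proj j : (Fin 3 → ℝ) →L[ℝ] ℝ) x :=
      (ContinuousLinearMap.proj j : (Fin 3 → ℝ) →L[ℝ] ℝ).hasFDerivAt
    simp only [map_mul, eval_X]
    refine (hp.mul hj).congr_fderiv ?_
    ext v
    simp [pderiv_X, Pi.single_apply, add_mul, Finset.sum_add_distrib,
      apply_ite (eval x), Finset.mul_sum]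
    exact Finset.sum_congr rfl fun i _ => by ring

namespace Cube

theorem integrableOn_toSet (K : Cube) (p : Poly) :
    IntegrableOn (fun x => eval x p) K.toSet := by
  have hc : Continuous fun x : Fin 3 → ℝ => eval x p := MvPolynomial.continuous_eval p
  refine (hc.continuousOn.integrableOn_compact (isCompact_univ_pi fun i =>
    isCompact_Icc (a := K.c i - K.h i) (b := K.c i + K.h i))).mono_set ?_
  exact Set.pi_mono fun i _ => Set.Ioo_subset_Icc_self

/-- The integral `∫_K p dV` as a linear functional on polynomials. -/
def boxIntegral (K : Cube) : Poly →ₗ[ℝ] ℝ where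
  toFun p := ∫ x in K.toSet, eval x p
  map_add' p q := by
    simp only [map_add]
    exact integral_add (K.integrableOn_toSet p) (K.integrableOn_toSet q)
  map_smul' a p := by
    simp only [smul_eval, RingHom.id_apply, smul_eq_mul]
    exact integral_const_mul _ _

theorem inner_eq_boxIntegral (K : Cube) (u q : VecPoly) : K.inner u q = K.boxIntegral (u ⬝ᵥ q) :=
  rfl

theorem isOpen_toSet (K : Cube) : IsOpen K.toSet :=
  isOpen_set_pi Set.finite_univ fun _ _ => isOpen_Ioo

theorem eval_eq_zero_of_boxIntegral_eq_zero (K : Cube) {p : Poly}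
    (hp : ∀ x ∈ K.toSet, 0 ≤ eval x p) (h0 : K.boxIntegral p = 0) :
    ∀ x ∈ K.toSet, eval x p = 0 := by
  have hm : MeasurableSet K.toSet := K.isOpen_toSet.measurableSet
  have h1 := (setIntegral_eq_zero_iff_of_nonneg_ae
    (ae_restrict_of_forall_mem hm hp) (K.integrableOn_toSet p)).1 h0
  exact Measure.eqOn_open_of_ae_eq (g := fun _ => (0 : ℝ)) h1 K.isOpen_toSet
    (MvPolynomial.continuous_eval p).continuousOn continuousOn_const

theorem eq_zero_of_eval_eq_zero (K : Cube) {p : Poly} (hp : ∀ x ∈ K.toSet, eval x p = 0) :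
    p = 0 := by
  refine MvPolynomial.funext_set (fun i => Set.Ioo (K.c i - K.h i) (K.c i + K.h i))
    (fun i => Set.Ioo_infinite (by have := K.h_pos i; linarith)) fun x hx => ?_
  rw [hp x hx, map_zero]

theorem eval_lam_pos (K : Cube) (f : Face) {x : Fin 3 → ℝ} (hx : x ∈ K.toSet) :
    0 < eval x (K.lam f) := by
  have h := hx f.1 (Set.mem_univ _)
  unfold lam
  split_ifs <;> simp <;> linarith [h.1, h.2]

/-- If the weights `b i` are positive in the box then `∫ ∑ b_i v_i²` is definite. -/
theorem eq_zero_of_boxIntegral_weighted_sq (K : Cube) {b v : VecPoly}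
    (hb : ∀ i, ∀ x ∈ K.toSet, 0 < eval x (b i))
    (h0 : K.boxIntegral (∑ i, b i * v i ^ 2) = 0) : v = 0 := by
  have hn : ∀ x ∈ K.toSet, ∀ i, 0 ≤ eval x (b i) * eval x (v i) ^ 2 := fun x hx i =>
    mul_nonneg (hb i x hx).le (sq_nonneg _)
  have h1 := K.eval_eq_zero_of_boxIntegral_eq_zero (p := ∑ i, b i * v i ^ 2) (fun x hx => by
    simp only [map_sum, map_mul, map_pow]
    exact Finset.sum_nonneg fun i _ => hn x hx i) h0
  funext i
  refine K.eq_zero_of_eval_eq_zero fun x hx => ?_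
  have h2 := h1 x hx
  simp only [map_sum, map_mul, map_pow] at h2
  have h3 := (Finset.sum_eq_zero_iff_of_nonneg fun i _ => hn x hx i).1 h2 i (Finset.mem_univ i)
  exact pow_eq_zero_iff (two_ne_zero) |>.1 ((mul_eq_zero.1 h3).resolve_left (hb i x hx).ne')

theorem continuous_eval_insertNth (f : Face) (a : ℝ) (p : Poly) :
    Continuous fun y : Fin 2 → ℝ => eval (f.1.insertNth (α := fun _ => ℝ) a y) p :=
  (MvPolynomial.continuous_eval p).comp (continuous_const.finInsertNth f.1 continuous_id)

/-- The surface integral over a face as a linear functional on polynomials. -/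
def faceIntegralLinear (K : Cube) (f : Face) : Poly →ₗ[ℝ] ℝ where
  toFun p := K.faceIntegral f p
  map_add' p q := by
    unfold faceIntegral
    simp only [map_add]
    exact integral_add
      ((continuous_eval_insertNth f _ p).continuousOn.integrableOn_compact isCompact_Icc)
      ((continuous_eval_insertNth f _ q).continuousOn.integrableOn_compact isCompact_Icc)
  map_smul' a p := by
    unfold faceIntegral
    simp only [smul_eval, RingHom.id_apply, smul_eq_mul]
    exact integral_const_mul _ _

theorem faceIntegralLinear_apply (K : Cube) (f : Face) (p : Poly) :
    K.faceIntegralLinear f p = K.faceIntegral f p := rfl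

theorem eval_insertNth_faceRestrict (K : Cube) (f : Face) (p : Poly) (y : Fin 2 → ℝ) :
    eval (f.1.insertNth (α := fun _ => ℝ) (K.facePos f) y) (faceRestrict K f p) =
      eval (f.1.insertNth (α := fun _ => ℝ) (K.facePos f) y) p := by
  rw [eval_faceRestrict, Fin.update_insertNth]

theorem faceIntegral_faceRestrict (K : Cube) (f : Face) (p : Poly) :
    K.faceIntegral f (faceRestrict K f p) = K.faceIntegral f p := by
  unfold faceIntegral
  simp only [eval_insertNth_faceRestrict]

theorem faceIntegral_congr (K : Cube) (f : Face) {p q : Poly}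
    (h : faceRestrict K f p = faceRestrict K f q) : K.faceIntegral f p = K.faceIntegral f q := by
  rw [← faceIntegral_faceRestrict, h, faceIntegral_faceRestrict]

/-- A polynomial field whose square has vanishing face integral vanishes on the face. -/
theorem faceRestrict_eq_zero_of_faceIntegral_sum_sq (K : Cube) (f : Face) {v : VecPoly}
    (h0 : K.faceIntegral f (∑ i, v i ^ 2) = 0) (i : Fin 3) : faceRestrict K f (v i) = 0 := by
  set a : Fin 2 → ℝ := fun j => K.c (f.1.succAbove j) - K.h (f.1.succAbove j) with ha
  set b : Fin 2 → ℝ := fun j => K.c (f.1.succAbove j) + K.h (f.1.succAbove j) with hb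
  set U : Set (Fin 2 → ℝ) := Set.univ.pi fun j => Set.Ioo (a j) (b j) with hU
  have hUo : IsOpen U := isOpen_set_pi Set.finite_univ fun _ _ => isOpen_Ioo
  have hc := continuous_eval_insertNth f (K.facePos f) (∑ i, v i ^ 2)
  have hn : ∀ y : Fin 2 → ℝ,
      0 ≤ eval (f.1.insertNth (α := fun _ => ℝ) (K.facePos f) y) (∑ i, v i ^ 2) := by
    intro y
    simp only [map_sum, map_pow]
    exact Finset.sum_nonneg fun i _ => sq_nonneg _
  have h1 := (setIntegral_eq_zero_iff_of_nonneg_ae (Filter.Eventually.of_forall hn)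
    (hc.continuousOn.integrableOn_compact isCompact_Icc)).1 h0
  have hsub : U ⊆ Set.Icc a b := by
    intro y hy
    exact ⟨fun j => (hy j (Set.mem_univ _)).1.le, fun j => (hy j (Set.mem_univ _)).2.le⟩
  have h2 := Measure.eqOn_open_of_ae_eq (g := fun _ => (0 : ℝ))
    (ae_restrict_of_ae_restrict_of_subset hsub h1) hUo hc.continuousOn continuousOn_const
  refine K.eq_zero_of_eval_eq_zero fun x hx => ?_
  have hy : (fun j => x (f.1.succAbove j)) ∈ U := fun j _ => hx _ (Set.mem_univ _)
  have h3 := h2 hy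
  simp only [map_sum, map_pow] at h3
  have h4 := (Finset.sum_eq_zero_iff_of_nonneg fun i _ => sq_nonneg _).1 h3 i (Finset.mem_univ i)
  have h5 := pow_eq_zero_iff (two_ne_zero) |>.1 h4
  rw [eval_faceRestrict, ← h5]
  congr 2
  rw [Fin.eq_insertNth_iff]
  constructor
  · simp
  · funext j; simp [Fin.removeNth]

/-- The divergence theorem for a polynomial field with vanishing normal components on the
boundary. -/
theorem boxIntegral_divergence_eq_zero (K : Cube) {F : VecPoly}
    (hF : ∀ f : Face, faceRestrict K f (F f.1) = 0) :
    K.boxIntegral (∑ i, pderiv i (F i)) = 0 := by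
  have hle : (fun i => K.c i - K.h i) ≤ fun i => K.c i + K.h i := fun i => by
    have := K.h_pos i
    show K.c i - K.h i ≤ K.c i + K.h i
    linarith
  have hd : ∀ x, eval x (∑ i, pderiv i (F i)) =
      ∑ i, (∑ j, eval x (pderiv j (F i)) •
        (ContinuousLinearMap.proj j : (Fin 3 → ℝ) →L[ℝ] ℝ)) (Pi.single i 1) := by
    intro x
    rw [map_sum]
    refine Finset.sum_congr rfl fun i _ => ?_
    simp [Pi.single_apply]
  have h := integral_divergence_of_hasFDerivAt_off_countable' (fun i => K.c i - K.h i)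
    (fun i => K.c i + K.h i) hle (fun i x => eval x (F i))
    (fun i x => ∑ j, eval x (pderiv j (F i)) •
      (ContinuousLinearMap.proj j : (Fin 3 → ℝ) →L[ℝ] ℝ)) ∅ Set.countable_empty
    (fun i => (MvPolynomial.continuous_eval (F i)).continuousOn)
    (fun x _ i => hasFDerivAt_eval (F i) x)
    (by
      simp only [← hd]
      exact (MvPolynomial.continuous_eval _).continuousOn.integrableOn_compact isCompact_Icc)
  simp only [← hd] at h
  have hset : K.toSet =ᵐ[volume] Set.Icc (fun i => K.c i - K.h i) (fun i => K.c i + K.h i) :=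
    Measure.univ_pi_Ioo_ae_eq_Icc
  show ∫ x in K.toSet, eval x (∑ i, pderiv i (F i)) = 0
  rw [setIntegral_congr_set hset, h]
  refine Finset.sum_eq_zero fun i _ => ?_
  have front : ∀ y : Fin 2 → ℝ,
      eval (i.insertNth (α := fun _ => ℝ) (K.c i + K.h i) y) (F i) = 0 := fun y => by
    have := eval_insertNth_faceRestrict K (i, true) (F i) y
    rw [hF (i, true), map_zero] at this
    simpa [facePos] using this.symm
  have back : ∀ y : Fin 2 → ℝ,
      eval (i.insertNth (α := fun _ => ℝ) (K.c i - K.h i) y) (F i) = 0 := fun y => by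
    have := eval_insertNth_faceRestrict K (i, false) (F i) y
    rw [hF (i, false), map_zero] at this
    simpa [facePos] using this.symm
  simp [front, back]

theorem faceRestrict_bubble (K : Cube) (f : Face) : faceRestrict K f K.bubble = 0 := by
  rw [← lam_mul_faceBubble K f, map_mul, faceRestrict_lam_self, zero_mul]

/-- Integration by parts: the curl is symmetric when one field vanishes on the boundary. -/
theorem inner_curl_bubble (K : Cube) (m p : VecPoly) :
    K.inner (curl (mulBy K.bubble m)) p = K.inner (mulBy K.bubble m) (curl p) := by
  rw [inner_eq_boxIntegral, inner_eq_boxIntegral, ← sub_eq_zero, ← map_sub]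
  have h := K.boxIntegral_divergence_eq_zero
    (F := crossProduct (mulBy K.bubble m) p) (fun f => by
      have : crossProduct (mulBy K.bubble m) p = K.bubble • crossProduct m p :=
        LinearMap.map_smul₂ _ _ _ _
      rw [this, Pi.smul_apply, smul_eq_mul, map_mul, faceRestrict_bubble, zero_mul])
  rw [← h]
  congr 1
  generalize mulBy K.bubble m = v
  simp only [curl, LinearMap.coe_mk, AddHom.coe_mk, cross_apply, dotProduct,
    Fin.sum_univ_three, Matrix.cons_val, map_sub, pderiv_mul]
  ring

end Cube

/-! ### Traces and moments of the curl bubbles -/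

theorem crossConst_apply (n : Fin 3 → ℝ) (u : VecPoly) :
    crossConst n u = ![u 1 * C (n 2) - u 2 * C (n 1), u 2 * C (n 0) - u 0 * C (n 2),
      u 0 * C (n 1) - u 1 * C (n 0)] := by
  show crossProduct u (constVec n) = _
  rw [cross_apply]
  rfl

theorem mulBy_apply (p : Poly) (u : VecPoly) (i : Fin 3) : mulBy p u i = p * u i := rfl

theorem mulBy_mulBy (p q : Poly) (u : VecPoly) : mulBy p (mulBy q u) = mulBy (p * q) u := by
  funext i
  simp only [mulBy_apply, mul_assoc]

theorem crossConst_single_self (i : Fin 3) (a : ℝ) (u : VecPoly) :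
    crossConst (Pi.single i a) u i = 0 := by
  rw [crossConst_apply]
  fin_cases i <;> simp

theorem crossConst_single_crossConst_single (i : Fin 3) (a b : ℝ) {u : VecPoly} (hu : u i = 0) :
    crossConst (Pi.single i a) (crossConst (Pi.single i b) u) = -(a * b) • u := by
  rw [crossConst_apply, crossConst_apply]
  funext j
  fin_cases i <;> fin_cases j <;> simp at hu <;> simp [hu, smul_eq_C_mul] <;> ring

theorem crossConst_mem_vecP {k : ℤ} {u : VecPoly} (hu : u ∈ vecP k) (n : Fin 3 → ℝ) :
    crossConst n u ∈ vecP k := by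
  rw [mem_vecP] at hu ⊢
  have h : ∀ i a, u i * C a ∈ P k := fun i a => by
    rw [mul_comm, ← smul_eq_C_mul]
    exact Submodule.smul_mem _ _ (hu i)
  rw [crossConst_apply]
  intro i
  fin_cases i <;> exact Submodule.sub_mem _ (h _ _) (h _ _)

/-- The unit normals `±n_f` are the vectors `ε e_i` with `ε = ±1`. -/
theorem outwardNormal_eq_single (f : Face) :
    ∃ ε : ℝ, ε * ε = 1 ∧ outwardNormal f = Pi.single f.1 ε := by
  refine ⟨if f.2 then 1 else -1, ?_, rfl⟩
  split_ifs <;> norm_num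

/-- The tangential fields `[P_k]³ × n_f` are the fields in `[P_k]³` without normal component. -/
theorem mem_map_crossConst {k : ℤ} {f : Face} {q : VecPoly} :
    q ∈ (vecP k).map (crossConst (outwardNormal f)) ↔ q ∈ vecP k ∧ q f.1 = 0 := by
  obtain ⟨ε, hε, hn⟩ := outwardNormal_eq_single f
  constructor
  · rintro ⟨p, hp, rfl⟩
    refine ⟨crossConst_mem_vecP hp _, ?_⟩
    rw [hn]
    exact crossConst_single_self _ _ _
  · rintro ⟨hq, h0⟩
    refine ⟨-crossConst (outwardNormal f) q, Submodule.neg_mem _ (crossConst_mem_vecP hq _), ?_⟩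
    rw [map_neg, hn, crossConst_single_crossConst_single _ _ _ h0, hε]
    simp

theorem faceRestrict_crossConst (K : Cube) (f : Face) (n : Fin 3 → ℝ) (u : VecPoly) (j : Fin 3) :
    faceRestrict K f (crossConst n u j) = crossConst n (fun i => faceRestrict K f (u i)) j := by
  rw [crossConst_apply, crossConst_apply]
  fin_cases j <;> simp

theorem pderiv_lam (K : Cube) (f : Face) (j : Fin 3) :
    pderiv j (K.lam f) = -C (outwardNormal f j) := by
  obtain ⟨i, b⟩ := f
  have h : ∀ a : ℝ, (Pi.single i a : Fin 3 → ℝ) j = if j = i then a else 0 := fun a =>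
    Pi.single_apply _ _ _
  have h' : (Pi.single j (1 : Poly) : Fin 3 → Poly) i = if j = i then 1 else 0 := by
    rw [Pi.single_apply]; simp only [eq_comm]
  cases b
  · simp only [Cube.lam, Bool.false_eq_true, if_false, outwardNormal, h, map_sub, pderiv_C,
      pderiv_X, h']
    split_ifs <;> simp
  · simp only [Cube.lam, if_true, outwardNormal, h, map_sub, pderiv_C, pderiv_X, h']
    split_ifs <;> simp

/-- On the face `f` only the gradient `-n_f` of the distance contributes to `curl (lam f • m)`. -/
theorem faceRestrict_curl_lam (K : Cube) (f : Face) (m : VecPoly) (j : Fin 3) :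
    faceRestrict K f (curl (mulBy (K.lam f) m) j) =
      crossConst (outwardNormal f) (fun i => faceRestrict K f (m i)) j := by
  rw [crossConst_apply]
  fin_cases j <;>
  · simp only [curl, LinearMap.coe_mk, AddHom.coe_mk, mulBy_apply, Matrix.cons_val, Fin.zero_eta,
      Fin.mk_one, Fin.reduceFinMk, pderiv_mul, pderiv_lam, map_sub, map_add, map_mul, map_neg,
      faceRestrict_lam_self, faceRestrict_C, zero_mul]
    ring

theorem faceRestrict_faceBubble_of_ne (K : Cube) {f g : Face} (h : g ≠ f) :
    faceRestrict K g (K.faceBubble f) = 0 := by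
  unfold Cube.faceBubble
  rw [map_prod]
  exact Finset.prod_eq_zero (Finset.mem_erase.2 ⟨h, Finset.mem_univ g⟩)
    (faceRestrict_lam_self K g)

theorem faceRestrict_faceBubble_ne_zero (K : Cube) (f : Face) :
    faceRestrict K f (K.faceBubble f) ≠ 0 := by
  unfold Cube.faceBubble
  rw [map_prod]
  exact Finset.prod_ne_zero_iff.2 fun g hg =>
    faceRestrict_lam_ne_zero K (Finset.ne_of_mem_erase hg)

theorem bubble_ne_zero (K : Cube) : K.bubble ≠ 0 := by
  rw [← K.lam_mul_faceBubble (0, true)]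
  refine mul_ne_zero (lam_ne_zero K _) fun h => ?_
  have := faceRestrict_faceBubble_ne_zero K (0, true)
  rw [h, map_zero] at this
  exact this rfl

/-- The divergence-free bubble `curl (B_K B_f q)` attached to the face `f`. -/
def curlBubble (K : Cube) (f : Face) : VecPoly →ₗ[ℝ] VecPoly :=
  curl ∘ₗ mulBy K.bubble ∘ₗ mulBy (K.faceBubble f)

theorem curlBubble_apply (K : Cube) (f : Face) (q : VecPoly) :
    curlBubble K f q = curl (mulBy K.bubble (mulBy (K.faceBubble f) q)) := rfl

theorem faceRestrict_curlBubble (K : Cube) (f g : Face) (q : VecPoly) (j : Fin 3) :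
    faceRestrict K g (curlBubble K f q j) = crossConst (outwardNormal g)
      (fun i => faceRestrict K g (K.faceBubble g * (K.faceBubble f * q i))) j := by
  rw [curlBubble_apply, ← K.lam_mul_faceBubble g, ← mulBy_mulBy, faceRestrict_curl_lam]
  rfl

theorem faceRestrict_curlBubble_of_ne (K : Cube) {f g : Face} (h : g ≠ f) (q : VecPoly)
    (j : Fin 3) : faceRestrict K g (curlBubble K f q j) = 0 := by
  have h0 : (fun i => faceRestrict K g (K.faceBubble g * (K.faceBubble f * q i))) =
      (0 : VecPoly) := by
    funext i
    rw [map_mul, map_mul, faceRestrict_faceBubble_of_ne K h]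
    simp
  rw [faceRestrict_curlBubble, h0, map_zero, Pi.zero_apply]

theorem faceRestrict_curlBubble_normal (K : Cube) (f g : Face) (q : VecPoly) :
    faceRestrict K g (curlBubble K f q g.1) = 0 := by
  rw [faceRestrict_curlBubble]
  exact crossConst_single_self _ _ _

theorem tangentialMoment_eq_zero (K : Cube) (f : Face) (n : Fin 3 → ℝ) {u : VecPoly} (q : VecPoly)
    (hu : ∀ j, faceRestrict K f (u j) = 0) : tangentialMoment K f n u q = 0 := by
  have h0 : (fun i => faceRestrict K f (u i)) = (0 : VecPoly) := funext hu
  unfold tangentialMoment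
  rw [K.faceIntegral_congr f (q := 0), ← Cube.faceIntegralLinear_apply, map_zero]
  simp [dotProduct, faceRestrict_crossConst, h0]

theorem faceIntegral_C_mul (K : Cube) (f : Face) (a : ℝ) (p : Poly) :
    K.faceIntegral f (C a * p) = a * K.faceIntegral f p := by
  rw [← smul_eq_C_mul, ← Cube.faceIntegralLinear_apply, map_smul]
  rfl

/-- The tangential moments of `curl (B_K B_f q)` on `f` are those of `-B_f² q`, up to the sign of
the normal. -/
theorem tangentialMoment_curlBubble (K : Cube) (f : Face) {ε : ℝ} (hε : ε * ε = 1) {q : VecPoly}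
    (hq : q f.1 = 0) (p : VecPoly) :
    ∃ δ : ℝ, δ ≠ 0 ∧ tangentialMoment K f (Pi.single f.1 ε) (curlBubble K f q) p =
      δ * K.faceIntegral f (∑ i, K.faceBubble f ^ 2 * q i * p i) := by
  obtain ⟨ε', hε', hn⟩ := outwardNormal_eq_single f
  refine ⟨-(ε * ε'), ?_, ?_⟩
  · intro h
    have : (ε * ε) * (ε' * ε') = 0 := by linear_combination -(ε * ε') * h
    rw [hε, hε'] at this
    norm_num at this
  · rw [← faceIntegral_C_mul]
    unfold tangentialMoment
    apply K.faceIntegral_congr f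
    simp only [dotProduct, map_sum, map_mul, faceRestrict_crossConst, faceRestrict_curlBubble]
    have e : (fun j => crossConst (outwardNormal f) (fun i => faceRestrict K f (K.faceBubble f) *
        (faceRestrict K f (K.faceBubble f) * faceRestrict K f (q i))) j) =
        crossConst (Pi.single f.1 ε') (fun i => faceRestrict K f (K.faceBubble f) *
          (faceRestrict K f (K.faceBubble f) * faceRestrict K f (q i))) := by rw [hn]
    rw [e, crossConst_single_crossConst_single _ _ _ (by simp [hq]), Finset.mul_sum]
    refine Finset.sum_congr rfl fun i _ => ?_
    rw [Pi.smul_apply, smul_eq_C_mul, faceRestrict_C, map_pow]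
    ring

theorem mem_faceVecP {f : Face} {k : ℤ} {q : VecPoly} :
    q ∈ faceVecP f k ↔ q f.1 = 0 ∧ ∀ j, j ≠ f.1 → q j ∈ faceP f k := by
  simp only [faceVecP, Submodule.mem_pi, Set.mem_univ, forall_const]
  constructor
  · intro h
    refine ⟨by simpa using h f.1, fun j hj => by simpa [hj] using h j⟩
  · rintro ⟨h0, h⟩ j
    by_cases hj : j = f.1
    · subst hj; simpa using h0
    · simpa [hj] using h j hj

theorem mem_faceV {K : Cube} {k : ℤ} {f : Face} {q : VecPoly} :
    q ∈ K.faceV k f ↔ (q ∈ vecP k ∧ q f.1 = 0) ∧ ∀ w ∈ vecP (k - 1), w f.1 = 0 →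
      K.inner q (mulBy (K.bubble * K.faceBubble f) w) = 0 := by
  show q ∈ (vecP k).map (crossConst (outwardNormal f)) ∧ (∀ w ∈ (vecP (k - 1)).map
    (crossConst (outwardNormal f)), K.inner q (mulBy (K.bubble * K.faceBubble f) w) = 0) ↔ _
  simp only [mem_map_crossConst, and_imp]

/-- The tangential moments on `f` determine the bubbles attached to `f`: vanishing moments make `q`
vanish on `f`, so `q = lam f • w` with `w` of lower degree, and `w` is an admissible test field in
the orthogonality relation defining `V_f^k`. -/
theorem eq_zero_of_tangentialMoment_curlBubble (K : Cube) {k : ℤ} (f : Face) {ε : ℝ}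
    (hε : ε * ε = 1) {q : VecPoly} (hq : q ∈ K.faceV k f)
    (h0 : ∀ p ∈ faceVecP f k,
      tangentialMoment K f (Pi.single f.1 ε) (curlBubble K f q) p = 0) : q = 0 := by
  obtain ⟨⟨hqP, hqf⟩, hort⟩ := mem_faceV.1 hq
  have h1 := h0 (fun i => faceRestrict K f (q i))
    (mem_faceVecP.2 ⟨by simp [hqf], fun j _ => faceRestrict_mem_faceP K f (mem_vecP.1 hqP j)⟩)
  obtain ⟨δ, hδ, e⟩ := tangentialMoment_curlBubble K f hε hqf (fun i => faceRestrict K f (q i))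
  rw [e] at h1
  have h2 := (mul_eq_zero.1 h1).resolve_left hδ
  have h3 : K.faceIntegral f (∑ i, (K.faceBubble f * q i) ^ 2) = 0 := by
    rw [← h2]
    apply K.faceIntegral_congr f
    simp only [map_sum, map_mul, map_pow, faceRestrict_faceRestrict]
    exact Finset.sum_congr rfl fun i _ => by ring
  have h4 : ∀ i, faceRestrict K f (q i) = 0 := fun i => by
    have := K.faceRestrict_eq_zero_of_faceIntegral_sum_sq f h3 i
    rw [map_mul] at this
    exact (mul_eq_zero.1 this).resolve_left (faceRestrict_faceBubble_ne_zero K f)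
  choose w hw hqw using fun i => exists_eq_lam_mul K f (mem_vecP.1 hqP i) (h4 i)
  have hwf : w f.1 = 0 := by
    have := hqw f.1
    rw [hqf] at this
    exact (mul_eq_zero.1 this.symm).resolve_left (lam_ne_zero K f)
  have h5 := hort w (mem_vecP.2 hw) hwf
  rw [Cube.inner_eq_boxIntegral] at h5
  have h6 : q ⬝ᵥ mulBy (K.bubble * K.faceBubble f) w = ∑ i, 1 * (K.bubble * w i) ^ 2 := by
    refine Finset.sum_congr rfl fun i _ => ?_
    rw [mulBy_apply, hqw, ← K.lam_mul_faceBubble f]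
    ring
  rw [h6] at h5
  have h7 := K.eq_zero_of_boxIntegral_weighted_sq (b := fun _ => 1) (v := fun i => K.bubble * w i)
    (fun _ _ _ => by simp) h5
  funext i
  have h8 := (mul_eq_zero.1 (congrFun h7 i)).resolve_left (bubble_ne_zero K)
  rw [hqw, h8, mul_zero, Pi.zero_apply]

/-- The bubbles do not contribute to the interior moments: integrate by parts and use that
`curl p` is an admissible test field in the orthogonality relation defining `V_f^k`. -/
theorem inner_curlBubble (K : Cube) {k : ℤ} (f : Face) {q p : VecPoly} (hq : q ∈ K.faceV k f)
    (hp : p ∈ vecP (k - 1)) : K.inner (curlBubble K f q) p = 0 := by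
  obtain ⟨⟨hqP, hqf⟩, hort⟩ := mem_faceV.1 hq
  have hc : curl p ∈ vecP (k - 1) :=
    mem_vecP.2 fun i => P_mono (by omega) (mem_vecP.1 (curl_mem_vecP hp) i)
  have hw : Function.update (curl p) f.1 0 ∈ vecP (k - 1) := mem_vecP.2 fun i => by
    by_cases h : i = f.1
    · subst h; simp
    · simpa [h] using mem_vecP.1 hc i
  have e : mulBy (K.bubble * K.faceBubble f) q ⬝ᵥ curl p =
      q ⬝ᵥ mulBy (K.bubble * K.faceBubble f) (Function.update (curl p) f.1 0) := by
    refine Finset.sum_congr rfl fun i _ => ?_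
    rw [mulBy_apply, mulBy_apply]
    by_cases h : i = f.1
    · subst h; simp [hqf]
    · rw [Function.update_of_ne h]; ring
  rw [curlBubble_apply, K.inner_curl_bubble, mulBy_mulBy, Cube.inner_eq_boxIntegral, e,
    ← Cube.inner_eq_boxIntegral]
  exact hort _ hw (by simp)

theorem normalMoment_single (K : Cube) (f : Face) (ε : ℝ) (u : VecPoly) (q : Poly) :
    normalMoment K f (Pi.single f.1 ε) u q = ε * K.faceIntegral f (u f.1 * q) := by
  have : u ⬝ᵥ constVec (Pi.single f.1 ε) = u f.1 * C ε := by
    unfold dotProduct constVec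
    rw [Finset.sum_eq_single f.1 (fun j _ hj => by simp [hj]) (by simp)]
    simp
  have e : u f.1 * C ε * q = C ε * (u f.1 * q) := by ring
  unfold normalMoment
  rw [this, ← faceIntegral_C_mul, e]

theorem normalMoment_eq_zero (K : Cube) (f : Face) (ε : ℝ) {u : VecPoly} (q : Poly)
    (hu : faceRestrict K f (u f.1) = 0) : normalMoment K f (Pi.single f.1 ε) u q = 0 := by
  rw [normalMoment_single, K.faceIntegral_congr f (q := 0) (by simp [hu]),
    ← Cube.faceIntegralLinear_apply, map_zero, mul_zero]

/-- The normal and interior moments determine the serendipity part. -/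
theorem eq_zero_of_normalMoment_of_inner (K : Cube) {k : ℕ} (hk : 1 ≤ k) {ε : Face → ℝ}
    (hε : ∀ f, ε f * ε f = 1) {p w : VecPoly} (hp : p ∈ vecP k) (hw : ∀ i, w i ∈ homIndep k i)
    (hn : ∀ f, ∀ q ∈ faceP f k,
      normalMoment K f (Pi.single f.1 (ε f)) (p + curl (serendipityField w)) q = 0)
    (hi : ∀ q ∈ vecP ((k : ℤ) - 2), K.inner (p + curl (serendipityField w)) q = 0) :
    p = 0 ∧ w = 0 := by
  set u := p + curl (serendipityField w) with hu
  have h0 : ∀ f : Face, faceRestrict K f (u f.1) = 0 := by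
    intro f
    have h1 := hn f _ (faceRestrict_normal_mem_faceP K f hp hw)
    rw [← hu, normalMoment_single] at h1
    have h2 := (mul_eq_zero.1 h1).resolve_left (left_ne_zero_of_mul_eq_one (hε f))
    have h3 : K.faceIntegral f (∑ i, (Pi.single f.1 (u f.1) : VecPoly) i ^ 2) = 0 := by
      rw [Finset.sum_eq_single f.1 (fun j _ hj => by simp [hj]) (by simp), Pi.single_eq_same,
        ← h2]
      apply K.faceIntegral_congr f
      rw [map_pow, map_mul, faceRestrict_faceRestrict, sq]
    simpa using K.faceRestrict_eq_zero_of_faceIntegral_sum_sq f h3 f.1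
  have hw0 : w = 0 := eq_zero_of_normal_eq_zero K hk hp hw h0
  refine ⟨?_, hw0⟩
  have hup : u = p := by rw [hu, hw0, map_zero, map_zero, add_zero]
  rw [hup] at h0 hi
  choose v hv hpv using fun i =>
    exists_eq_lam_mul_lam K i (mem_vecP.1 hp i) fun b => h0 (i, b)
  have h1 := hi v (mem_vecP.2 hv)
  rw [Cube.inner_eq_boxIntegral] at h1
  have h2 : p ⬝ᵥ v = ∑ i, K.lam (i, true) * K.lam (i, false) * v i ^ 2 := by
    refine Finset.sum_congr rfl fun i _ => ?_
    rw [hpv]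
    ring
  rw [h2] at h1
  have h3 := K.eq_zero_of_boxIntegral_weighted_sq
    (b := fun i => K.lam (i, true) * K.lam (i, false)) (fun i x hx => by
      rw [map_mul]
      exact mul_pos (K.eval_lam_pos _ hx) (K.eval_lam_pos _ hx)) h1
  funext i
  rw [hpv, h3, Pi.zero_apply, mul_zero]

/-! ### Dimensions of the polynomial spaces -/

theorem finite_degree_le (k : ℤ) : {s : Fin 3 →₀ ℕ | (s.degree : ℤ) ≤ k}.Finite :=
  (Finsupp.finite_of_degree_le k.toNat).subset fun s (hs : (s.degree : ℤ) ≤ k) => by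
    show s.degree ≤ k.toNat
    omega

theorem finite_degree_le_and (k : ℤ) (i : Fin 3) :
    {s : Fin 3 →₀ ℕ | (s.degree : ℤ) ≤ k ∧ s i = 0}.Finite :=
  (finite_degree_le k).subset fun _ hs => hs.1

theorem finite_degree_eq_and (k : ℤ) (i : Fin 3) :
    {s : Fin 3 →₀ ℕ | (s.degree : ℤ) = k ∧ s i = 0}.Finite :=
  (finite_degree_le k).subset fun _ hs => hs.1.le

theorem finite_restrictSupport {S : Set (Fin 3 →₀ ℕ)} (hS : S.Finite) :
    Module.Finite ℝ (restrictSupport ℝ S) :=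
  have := hS.to_subtype
  Module.Finite.of_basis (basisRestrictSupport ℝ S)

theorem finrank_restrictSupport (S : Set (Fin 3 →₀ ℕ)) :
    Module.finrank ℝ (restrictSupport ℝ S) = S.ncard :=
  Module.finrank_eq_nat_card_basis (basisRestrictSupport ℝ S)

instance (k : ℤ) : Module.Finite ℝ (P k) := finite_restrictSupport (finite_degree_le k)

instance (f : Face) (k : ℤ) : Module.Finite ℝ (faceP f k) :=
  finite_restrictSupport (finite_degree_le_and k f.1)

instance (k : ℤ) (i : Fin 3) : Module.Finite ℝ (homIndep k i) :=
  finite_restrictSupport (finite_degree_eq_and k i)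

/-- Shifting the degree bound by `3` covers the zero space `P k`, `k < 0`, by the same formula. -/
theorem ncard_degree_le (n : ℕ) :
    {s : Fin 3 →₀ ℕ | (s.degree : ℤ) ≤ (n : ℤ) - 3}.ncard = n.choose 3 := by
  have h : {s : Fin 3 →₀ ℕ | (s.degree : ℤ) ≤ (n : ℤ) - 3} =
      ((Finset.range (n - 2)).biUnion fun m => Finset.finsuppAntidiag Finset.univ m :
        Finset (Fin 3 →₀ ℕ)) := by
    ext s
    simp only [Set.mem_ofPred_eq, Finset.coe_biUnion, Set.mem_iUnion, Finset.mem_coe,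
      Finset.mem_range, Finset.mem_finsuppAntidiag, Finset.subset_univ, and_true,
      ← Finsupp.degree_eq_sum, exists_prop]
    constructor
    · intro h
      exact ⟨s.degree, by omega, rfl⟩
    · rintro ⟨m, hm, rfl⟩
      omega
  rw [h, Set.ncard_coe_finset, Finset.card_biUnion]
  · have h1 : ∀ m, (Finset.finsuppAntidiag (Finset.univ : Finset (Fin 3)) m).card =
        (m + 2).choose 2 := by
      intro m
      rw [Finset.card_finsuppAntidiag_nat_eq_choose]
      rw [Finset.card_univ, Fintype.card_fin, show 3 + m - 1 = m + 2 by omega]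
      exact Nat.choose_symm_add
    simp only [h1]
    have h2 : ∀ N : ℕ, ∑ m ∈ Finset.range N, (m + 2).choose 2 = (N + 2).choose 3 := by
      intro N
      induction N with
      | zero => rfl
      | succ N ih =>
        rw [Finset.sum_range_succ, ih, Nat.choose_succ_succ' (N + 2) 2, add_comm]
    rw [h2]
    rcases Nat.lt_or_ge n 2 with hn | hn
    · interval_cases n <;> rfl
    · rw [Nat.sub_add_cancel hn]
  · intro a _ b _ hab
    rw [Function.onFun, Finset.disjoint_left]
    intro s ha hb
    rw [Finset.mem_finsuppAntidiag] at ha hb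
    exact hab (ha.1.symm.trans hb.1)

/-- The monomials of degree at most `n - 2` either do not contain `x_i` or are `x_i` times a monomial
of degree at most `n - 3`. -/
theorem ncard_degree_le_and (n : ℕ) (i : Fin 3) :
    {s : Fin 3 →₀ ℕ | (s.degree : ℤ) ≤ (n : ℤ) - 2 ∧ s i = 0}.ncard = n.choose 2 := by
  have h : {s : Fin 3 →₀ ℕ | (s.degree : ℤ) ≤ ((n + 1 : ℕ) : ℤ) - 3} =
      {s | (s.degree : ℤ) ≤ (n : ℤ) - 2 ∧ s i = 0} ∪
        (fun s => s + Finsupp.single i 1) '' {s | (s.degree : ℤ) ≤ (n : ℤ) - 3} := by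
    ext s
    simp only [Set.mem_ofPred_eq, Set.mem_union, Set.mem_image]
    constructor
    · intro hs
      by_cases hi : s i = 0
      · exact Or.inl ⟨by push_cast at hs; omega, hi⟩
      · have h2 : (s - Finsupp.single i 1) + Finsupp.single i 1 = s :=
          tsub_add_cancel_of_le (by
            rw [Finsupp.single_le_iff]; exact Nat.one_le_iff_ne_zero.2 hi)
        refine Or.inr ⟨_, ?_, h2⟩
        rw [← h2, map_add, Finsupp.degree_single] at hs
        push_cast at hs
        omega
    · rintro (⟨hs, -⟩ | ⟨t, ht, rfl⟩)
      · push_cast; omega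
      · rw [map_add, Finsupp.degree_single]; push_cast; omega
  have hd : Disjoint {s : Fin 3 →₀ ℕ | (s.degree : ℤ) ≤ (n : ℤ) - 2 ∧ s i = 0}
      ((fun s => s + Finsupp.single i 1) '' {s | (s.degree : ℤ) ≤ (n : ℤ) - 3}) := by
    rw [Set.disjoint_left]
    rintro _ ⟨-, hi⟩ ⟨t, -, rfl⟩
    simp at hi
  have hc := congrArg Set.ncard h
  rw [Set.ncard_union_eq hd (finite_degree_le_and _ i) ((finite_degree_le _).image _),
    Set.ncard_image_of_injective _ (add_left_injective _), ncard_degree_le, ncard_degree_le,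
    Nat.choose_succ_succ' n 2, show 2 + 1 = 3 from rfl] at hc
  omega

theorem ncard_degree_eq_and (k : ℕ) (i : Fin 3) :
    {s : Fin 3 →₀ ℕ | (s.degree : ℤ) = k ∧ s i = 0}.ncard = k + 1 := by
  have h : {s : Fin 3 →₀ ℕ | (s.degree : ℤ) ≤ ((k + 2 : ℕ) : ℤ) - 2 ∧ s i = 0} =
      {s | (s.degree : ℤ) = k ∧ s i = 0} ∪
        {s | (s.degree : ℤ) ≤ ((k + 1 : ℕ) : ℤ) - 2 ∧ s i = 0} := by
    ext s
    simp only [Set.mem_ofPred_eq, Set.mem_union]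
    push_cast
    omega
  have hd : Disjoint {s : Fin 3 →₀ ℕ | (s.degree : ℤ) = k ∧ s i = 0}
      {s | (s.degree : ℤ) ≤ ((k + 1 : ℕ) : ℤ) - 2 ∧ s i = 0} := by
    rw [Set.disjoint_left]
    rintro s ⟨h1, -⟩ ⟨h2, -⟩
    push_cast at h2
    omega
  have hc := congrArg Set.ncard h
  rw [Set.ncard_union_eq hd (finite_degree_eq_and _ i) (finite_degree_le_and _ i),
    ncard_degree_le_and, ncard_degree_le_and, Nat.choose_succ_succ' (k + 1) 1,
    Nat.choose_one_right, show 1 + 1 = 2 from rfl] at hc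
  omega

theorem finrank_P (n : ℕ) : Module.finrank ℝ (P ((n : ℤ) - 3)) = n.choose 3 :=
  (finrank_restrictSupport _).trans (ncard_degree_le n)

theorem finrank_faceP (f : Face) (n : ℕ) :
    Module.finrank ℝ (faceP f ((n : ℤ) - 2)) = n.choose 2 :=
  (finrank_restrictSupport _).trans (ncard_degree_le_and n f.1)

theorem finrank_homIndep (k : ℕ) (i : Fin 3) : Module.finrank ℝ (homIndep k i) = k + 1 :=
  (finrank_restrictSupport _).trans (ncard_degree_eq_and k i)

/-- A product of submodules, as a submodule of the product, is the product of the modules. -/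
def submodulePiEquiv (p : Fin 3 → Submodule ℝ Poly) :
    Submodule.pi Set.univ p ≃ₗ[ℝ] ∀ i, p i where
  toFun u i := ⟨u.1 i, u.2 i (Set.mem_univ i)⟩
  map_add' _ _ := rfl
  map_smul' _ _ := rfl
  invFun v := ⟨fun i => v i, fun i _ => (v i).2⟩
  left_inv _ := rfl
  right_inv _ := rfl

theorem finrank_submodulePi (p : Fin 3 → Submodule ℝ Poly) [∀ i, Module.Finite ℝ (p i)] :
    Module.finrank ℝ (Submodule.pi Set.univ p) = ∑ i, Module.finrank ℝ (p i) := by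
  rw [(submodulePiEquiv p).finrank_eq, Module.finrank_pi_fintype]

instance finite_submodulePi (p : Fin 3 → Submodule ℝ Poly) [∀ i, Module.Finite ℝ (p i)] :
    Module.Finite ℝ (Submodule.pi Set.univ p) :=
  Module.Finite.equiv (submodulePiEquiv p).symm

instance (k : ℤ) : Module.Finite ℝ (vecP k) := finite_submodulePi _

theorem finrank_vecP (n : ℕ) : Module.finrank ℝ (vecP ((n : ℤ) - 3)) = 3 * n.choose 3 := by
  rw [vecP, finrank_submodulePi]
  simp [finrank_P]

theorem finite_ite (i j : Fin 3) (p : Submodule ℝ Poly) [Module.Finite ℝ p] :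
    Module.Finite ℝ (if j = i then ⊥ else p : Submodule ℝ Poly) := by
  by_cases h : j = i
  · rw [if_pos h]; infer_instance
  · rw [if_neg h]; infer_instance

theorem finrank_submodulePi_ite (i : Fin 3) (p : Submodule ℝ Poly) [Module.Finite ℝ p] :
    Module.finrank ℝ (Submodule.pi Set.univ fun j : Fin 3 =>
      (if j = i then ⊥ else p : Submodule ℝ Poly)) = 2 * Module.finrank ℝ p := by
  have := fun j => finite_ite i j p
  rw [finrank_submodulePi, ← Finset.add_sum_erase _ _ (Finset.mem_univ i), if_pos rfl,
    finrank_bot, zero_add,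
    Finset.sum_congr rfl fun j hj => by rw [if_neg (Finset.ne_of_mem_erase hj)],
    Finset.sum_const, Finset.card_erase_of_mem (Finset.mem_univ i)]
  rfl

instance (f : Face) (k : ℤ) : Module.Finite ℝ (faceVecP f k) :=
  have := fun j => finite_ite f.1 j (faceP f k)
  finite_submodulePi _

theorem finrank_faceVecP (f : Face) (n : ℕ) :
    Module.finrank ℝ (faceVecP f ((n : ℤ) - 2)) = 2 * n.choose 2 := by
  rw [faceVecP, finrank_submodulePi_ite, finrank_faceP]

theorem map_crossConst_eq (k : ℤ) (f : Face) :
    (vecP k).map (crossConst (outwardNormal f)) =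
      Submodule.pi Set.univ fun j => if j = f.1 then ⊥ else P k := by
  ext q
  rw [mem_map_crossConst, mem_vecP]
  simp only [Submodule.mem_pi, Set.mem_univ, forall_const]
  constructor
  · rintro ⟨h, h0⟩ j
    by_cases hj : j = f.1
    · subst hj; simpa using h0
    · simpa [hj] using h j
  · intro h
    have h0 : q f.1 = 0 := by simpa using h f.1
    refine ⟨fun j => ?_, h0⟩
    by_cases hj : j = f.1
    · subst hj; rw [h0]; exact Submodule.zero_mem _
    · simpa [hj] using h j

theorem finrank_map_crossConst (n : ℕ) (f : Face) :
    Module.finrank ℝ ((vecP ((n : ℤ) - 3)).map (crossConst (outwardNormal f))) =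
      2 * n.choose 3 := by
  rw [map_crossConst_eq, finrank_submodulePi_ite, finrank_P]

instance (K : Cube) (k : ℤ) (f : Face) : Module.Finite ℝ (K.faceV k f) :=
  Module.Finite.of_injective (Submodule.inclusion
    (fun _ hq => hq.1 : K.faceV k f ≤ (vecP k).map (crossConst (outwardNormal f))))
    (Submodule.inclusion_injective _)

namespace Cube

/-- The bilinear form `(u, q) ↦ (u, q)_K`. -/
def innerBilin (K : Cube) : VecPoly →ₗ[ℝ] VecPoly →ₗ[ℝ] ℝ :=
  LinearMap.mk₂ ℝ K.inner
    (fun _ _ _ => by simp only [inner_eq_boxIntegral, add_dotProduct, map_add])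
    (fun _ _ _ => by simp only [inner_eq_boxIntegral, smul_dotProduct, map_smul])
    (fun _ _ _ => by simp only [inner_eq_boxIntegral, dotProduct_add, map_add])
    (fun _ _ _ => by simp only [inner_eq_boxIntegral, dotProduct_smul, map_smul])

theorem innerBilin_apply (K : Cube) (u q : VecPoly) : K.innerBilin u q = K.inner u q := rfl

/-- The orthogonality relations defining `V_f^k` are at most `dim ([P_{k-1}]³ × n_f)` many. -/
theorem le_finrank_faceV (K : Cube) (n : ℕ) (f : Face) :
    2 * n.choose 2 ≤ Module.finrank ℝ (K.faceV ((n : ℤ) - 2) f) := by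
  set W := (vecP ((n : ℤ) - 2)).map (crossConst (outwardNormal f)) with hW
  set W' := (vecP ((n : ℤ) - 2 - 1)).map (crossConst (outwardNormal f)) with hW'
  let T : W →ₗ[ℝ] Module.Dual ℝ W' :=
    (((K.innerBilin.compl₂ (mulBy (K.bubble * K.faceBubble f))).domRestrict₁₂ W W'))
  have hker : (LinearMap.ker T).map W.subtype = K.faceV ((n : ℤ) - 2) f := by
    ext q
    constructor
    · rintro ⟨q, hq, rfl⟩
      exact ⟨q.2, fun w hw => LinearMap.congr_fun (LinearMap.mem_ker.1 hq) (⟨w, hw⟩ : W')⟩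
    · rintro ⟨hq, ho⟩
      exact ⟨⟨q, hq⟩, LinearMap.mem_ker.2 (LinearMap.ext fun w => ho w w.2), rfl⟩
  have hWn : Module.finrank ℝ W = 2 * (n + 1).choose 3 := by
    rw [← finrank_map_crossConst (n + 1) f, hW,
      show ((n + 1 : ℕ) : ℤ) - 3 = (n : ℤ) - 2 by push_cast; ring]
  have hWn' : Module.finrank ℝ W' = 2 * n.choose 3 := by
    rw [← finrank_map_crossConst n f, hW', show (n : ℤ) - 2 - 1 = (n : ℤ) - 3 by ring]
  have hdim := LinearMap.finrank_range_add_finrank_ker T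
  have hrange := Submodule.finrank_le (LinearMap.range T)
  rw [Subspace.dual_finrank_eq, hWn'] at hrange
  rw [← hker, Submodule.finrank_map_subtype_eq]
  rw [hWn, Nat.choose_succ_succ' n 2, show 2 + 1 = 3 from rfl] at hdim
  omega

end Cube

/-! ### Parametrization of the enriched space and its degrees of freedom -/

/-- The supplementary functions `w` of the serendipity space `S²_k`. -/
abbrev supplement (k : ℤ) : Submodule ℝ VecPoly :=
  Submodule.pi Set.univ fun i => homIndep k i

theorem finrank_supplement (k : ℕ) : Module.finrank ℝ (supplement k) = 3 * (k + 1) := by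
  rw [finrank_submodulePi]
  simp [finrank_homIndep]

namespace Cube

/-- The map `(p, w, q) ↦ p + curl (serendipityField w) + ∑_f curl (B_K B_f q_f)`, which
parametrizes the enriched space. -/
def param (K : Cube) (r : ℕ) :
    vecP ((r : ℤ) - 1) × supplement ((r : ℤ) - 1) × (∀ f, K.faceV ((r : ℤ) - 2) f) →ₗ[ℝ]
      VecPoly :=
  (vecP ((r : ℤ) - 1)).subtype.coprod
    (((curl ∘ₗ serendipityField) ∘ₗ (supplement ((r : ℤ) - 1)).subtype).coprod
      (∑ f, (curlBubble K f ∘ₗ (K.faceV ((r : ℤ) - 2) f).subtype) ∘ₗ LinearMap.proj f))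

theorem param_apply (K : Cube) (r : ℕ) (p : vecP ((r : ℤ) - 1)) (w : supplement ((r : ℤ) - 1))
    (q : ∀ f, K.faceV ((r : ℤ) - 2) f) :
    K.param r (p, w, q) =
      (p : VecPoly) + curl (serendipityField w) + ∑ f, curlBubble K f (q f) := by
  simp [param, add_assoc]

theorem mem_S2 {k : ℤ} {u : VecPoly} :
    u ∈ S2 k ↔ ∃ (p : vecP k) (w : supplement k),
      u = (p : VecPoly) + curl (serendipityField w) := by
  simp only [S2, Submodule.mem_sup]
  constructor
  · rintro ⟨p, hp, _, ⟨_, ⟨w, hw, rfl⟩, rfl⟩, rfl⟩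
    exact ⟨⟨p, hp⟩, ⟨w, hw⟩, rfl⟩
  · rintro ⟨p, w, rfl⟩
    exact ⟨p, p.2, _, ⟨_, ⟨w, w.2, rfl⟩, rfl⟩, rfl⟩

theorem mem_bubbleU {K : Cube} {k : ℤ} {u : VecPoly} :
    u ∈ K.bubbleU k ↔ ∃ q : ∀ f, K.faceV k f, u = ∑ f, curlBubble K f (q f) := by
  have h : K.bubbleU k = ⨆ f, (K.faceV k f).map (curlBubble K f) := by
    simp only [bubbleU, bubbleV, Submodule.map_iSup, ← Submodule.map_comp]
    rfl
  rw [h]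
  constructor
  · intro hu
    induction hu using Submodule.iSup_induction' with
    | mem f x hx =>
      obtain ⟨q, hq, rfl⟩ := hx
      refine ⟨Pi.single f ⟨q, hq⟩, ?_⟩
      rw [Finset.sum_eq_single f (fun g _ hg => by simp [hg]) (by simp), Pi.single_eq_same]
    | zero => exact ⟨0, by simp⟩
    | add x y _ _ hx hy =>
      obtain ⟨q, rfl⟩ := hx
      obtain ⟨q', rfl⟩ := hy
      exact ⟨q + q', by simp [Finset.sum_add_distrib]⟩
  · rintro ⟨q, rfl⟩
    exact Submodule.sum_mem _ fun f _ =>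
      Submodule.mem_iSup_of_mem f (Submodule.mem_map_of_mem (q f).2)

theorem range_param (K : Cube) (r : ℕ) : LinearMap.range (K.param r) = K.S2plus r := by
  ext u
  rw [S2plus, Submodule.mem_sup]
  constructor
  · rintro ⟨⟨p, w, q⟩, rfl⟩
    rw [param_apply]
    exact ⟨_, mem_S2.2 ⟨p, w, rfl⟩, _, mem_bubbleU.2 ⟨q, rfl⟩, rfl⟩
  · rintro ⟨_, hs, _, hv, rfl⟩
    obtain ⟨p, w, rfl⟩ := mem_S2.1 hs
    obtain ⟨q, rfl⟩ := mem_bubbleU.1 hv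
    exact ⟨(p, w, q), param_apply K r p w q⟩

/-- The normal moments as a bilinear form. -/
def normalBilin (K : Cube) (f : Face) (n : Fin 3 → ℝ) : VecPoly →ₗ[ℝ] Poly →ₗ[ℝ] ℝ :=
  LinearMap.mk₂ ℝ (normalMoment K f n)
    (fun _ _ _ => by
      simp only [normalMoment, ← faceIntegralLinear_apply, add_dotProduct, add_mul, map_add])
    (fun _ _ _ => by
      simp only [normalMoment, ← faceIntegralLinear_apply, smul_dotProduct, smul_mul_assoc,
        map_smul])
    (fun _ _ _ => by simp only [normalMoment, ← faceIntegralLinear_apply, mul_add, map_add])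
    (fun _ _ _ => by
      simp only [normalMoment, ← faceIntegralLinear_apply, mul_smul_comm, map_smul])

theorem normalBilin_apply (K : Cube) (f : Face) (n : Fin 3 → ℝ) (u : VecPoly) (q : Poly) :
    K.normalBilin f n u q = normalMoment K f n u q := rfl

/-- The tangential moments as a bilinear form. -/
def tangentialBilin (K : Cube) (f : Face) (n : Fin 3 → ℝ) : VecPoly →ₗ[ℝ] VecPoly →ₗ[ℝ] ℝ :=
  LinearMap.mk₂ ℝ (tangentialMoment K f n)
    (fun _ _ _ => by
      simp only [tangentialMoment, ← faceIntegralLinear_apply, map_add, add_dotProduct])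
    (fun _ _ _ => by
      simp only [tangentialMoment, ← faceIntegralLinear_apply, map_smul, smul_dotProduct])
    (fun _ _ _ => by
      simp only [tangentialMoment, ← faceIntegralLinear_apply, dotProduct_add, map_add])
    (fun _ _ _ => by
      simp only [tangentialMoment, ← faceIntegralLinear_apply, dotProduct_smul, map_smul])

theorem tangentialBilin_apply (K : Cube) (f : Face) (n : Fin 3 → ℝ) (u q : VecPoly) :
    K.tangentialBilin f n u q = tangentialMoment K f n u q := rfl

/-- The degrees of freedom of a field: its three families of moments, as functionals on the test
spaces. -/
def dof (K : Cube) (r : ℕ) (n : Face → Fin 3 → ℝ) :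
    VecPoly →ₗ[ℝ] (∀ f : Face, Module.Dual ℝ (faceP f ((r : ℤ) - 1))) ×
      (∀ f : Face, Module.Dual ℝ (faceVecP f ((r : ℤ) - 2))) ×
      Module.Dual ℝ (vecP ((r : ℤ) - 3)) :=
  (LinearMap.pi fun f => (K.normalBilin f (n f)).compl₂ (faceP f ((r : ℤ) - 1)).subtype).prod
    ((LinearMap.pi fun f =>
      (K.tangentialBilin f (n f)).compl₂ (faceVecP f ((r : ℤ) - 2)).subtype).prod
      (K.innerBilin.compl₂ (vecP ((r : ℤ) - 3)).subtype))

theorem dof_eq_iff (K : Cube) (r : ℕ) (n : Face → Fin 3 → ℝ) (u : VecPoly)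
    (a : ∀ f : Face, Module.Dual ℝ (faceP f ((r : ℤ) - 1)))
    (b : ∀ f : Face, Module.Dual ℝ (faceVecP f ((r : ℤ) - 2)))
    (d : Module.Dual ℝ (vecP ((r : ℤ) - 3))) :
    K.dof r n u = (a, b, d) ↔
      (∀ f (q : faceP f ((r : ℤ) - 1)), normalMoment K f (n f) u q = a f q) ∧
      (∀ f (q : faceVecP f ((r : ℤ) - 2)), tangentialMoment K f (n f) u q = b f q) ∧
      ∀ q : vecP ((r : ℤ) - 3), interiorMoment K u q = d q := by
  simp only [Prod.ext_iff, funext_iff, LinearMap.ext_iff]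
  rfl

/-- Unisolvence in terms of the parametrization: the normal and interior moments see only the
serendipity part, and once this is zero the tangential moments on `f` see only the bubble attached
to `f`. -/
theorem dof_param_injective (K : Cube) (r : ℕ) (hr : 2 ≤ r) (n : Face → Fin 3 → ℝ)
    (hn : ∀ f, n f = outwardNormal f ∨ n f = -outwardNormal f) :
    Function.Injective (K.dof r n ∘ₗ K.param r) := by
  have hε : ∀ f, ∃ ε : ℝ, ε * ε = 1 ∧ n f = Pi.single f.1 ε := by
    intro f
    obtain ⟨ε, h1, h2⟩ := outwardNormal_eq_single f
    rcases hn f with h | h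
    · exact ⟨ε, h1, h.trans h2⟩
    · exact ⟨-ε, by linarith, by rw [h, h2, Pi.single_neg]⟩
  choose ε hε hnε using hε
  rw [injective_iff_map_eq_zero]
  rintro ⟨p, w, q⟩ h
  rw [LinearMap.comp_apply, param_apply] at h
  obtain ⟨hN, hT, hI⟩ := (dof_eq_iff K r n _ 0 0 0).1 h
  -- `s` is the serendipity part and `v` the bubble part
  set s : VecPoly := (p : VecPoly) + curl (serendipityField w) with hs
  set v : VecPoly := ∑ f, curlBubble K f (q f) with hv
  obtain ⟨k, rfl⟩ : ∃ k, r = k + 1 := ⟨r - 1, by omega⟩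
  have hk1 : ((k + 1 : ℕ) : ℤ) - 1 = k := by push_cast; ring
  have hvN : ∀ f t, normalMoment K f (Pi.single f.1 (ε f)) v t = 0 := by
    intro f t
    refine normalMoment_eq_zero K f _ t ?_
    rw [hv, Finset.sum_apply, map_sum]
    exact Finset.sum_eq_zero fun g _ => faceRestrict_curlBubble_normal K g f _
  have hvI : ∀ t ∈ vecP (((k + 1 : ℕ) : ℤ) - 3), K.inner v t = 0 := by
    intro t ht
    have : K.inner v t = ∑ f, K.inner (curlBubble K f (q f)) t := by
      simp only [← innerBilin_apply]
      rw [hv, map_sum, LinearMap.sum_apply]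
    rw [this]
    refine Finset.sum_eq_zero fun f _ => inner_curlBubble K f (q f).2 ?_
    rwa [sub_sub]
  have hp : (p : VecPoly) ∈ vecP (k : ℤ) := hk1 ▸ p.2
  have hw : ∀ i, (w : VecPoly) i ∈ homIndep (k : ℤ) i := fun i =>
    hk1 ▸ w.2 i (Set.mem_univ i)
  obtain ⟨hp0, hw0⟩ := eq_zero_of_normalMoment_of_inner K (by omega) hε hp hw
    (fun f t ht => by
      have h1 := hN f ⟨t, hk1.symm ▸ ht⟩
      rw [hnε] at h1
      rwa [← normalBilin_apply, map_add, LinearMap.add_apply, normalBilin_apply,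
        normalBilin_apply, hvN f t, add_zero] at h1)
    (fun t ht => by
      have ht' : t ∈ vecP (((k + 1 : ℕ) : ℤ) - 3) := by
        rwa [show ((k + 1 : ℕ) : ℤ) - 3 = k - 2 by push_cast; ring]
      have h1 := hI ⟨t, ht'⟩
      rwa [interiorMoment, ← innerBilin_apply, map_add, LinearMap.add_apply, innerBilin_apply,
        innerBilin_apply, hvI t ht', add_zero] at h1)
  have hs0 : s = 0 := by rw [hs, hp0, hw0, map_zero, map_zero, add_zero]
  have hq0 : ∀ f, (q f : VecPoly) = 0 := by
    intro f
    refine eq_zero_of_tangentialMoment_curlBubble K f (hε f) (q f).2 fun t ht => ?_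
    have h1 := hT f ⟨t, ht⟩
    rw [hs0, zero_add, hnε] at h1
    rw [← tangentialBilin_apply, hv, map_sum, LinearMap.sum_apply] at h1
    simp only [tangentialBilin_apply] at h1
    -- only the bubble attached to `f` has a tangential trace on `f`
    have hne : ∀ g ∈ Finset.univ, g ≠ f →
        tangentialMoment K f (Pi.single f.1 (ε f)) (curlBubble K g (q g)) t = 0 := fun g _ hg =>
      tangentialMoment_eq_zero K f _ t fun j => faceRestrict_curlBubble_of_ne K hg.symm _ j
    rwa [Finset.sum_eq_single f hne (by simp)] at h1
  exact Prod.ext (Subtype.ext hp0) (Prod.ext (Subtype.ext hw0)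
    (funext fun f => Subtype.ext (hq0 f)))

end Cube

theorem six_mul_choose_three (n : ℕ) :
    6 * (n.choose 3 : ℝ) = n * ((n : ℝ) - 1) * ((n : ℝ) - 2) := by
  induction n with
  | zero => simp
  | succ n ih =>
    rw [Nat.choose_succ_succ' n 2, Nat.cast_add, Nat.cast_choose_two]
    push_cast
    linear_combination ih

end StokesFE

end

theorem theorem3p2 (r : ℕ) (hr : 2 ≤ r) (K : StokesFE.Cube)
    (n : StokesFE.Face → Fin 3 → ℝ)
    (hn : ∀ f, n f = StokesFE.outwardNormal f ∨ n f = -StokesFE.outwardNormal f) :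
    -- the sum defining the shape space is direct
    Disjoint (StokesFE.S2 ((r : ℤ) - 1)) (K.bubbleU ((r : ℤ) - 2)) ∧
    -- arbitrary prescribed values of the degrees of freedom are attained by exactly one element
    (∀ (a : ∀ f : StokesFE.Face, Module.Dual ℝ (StokesFE.faceP f ((r : ℤ) - 1)))
        (b : ∀ f : StokesFE.Face, Module.Dual ℝ (StokesFE.faceVecP f ((r : ℤ) - 2)))
        (d : Module.Dual ℝ (StokesFE.vecP ((r : ℤ) - 3))),
      ∃! u : StokesFE.VecPoly, u ∈ K.S2plus r ∧
        (∀ (f : StokesFE.Face) (q : StokesFE.faceP f ((r : ℤ) - 1)),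
          StokesFE.normalMoment K f (n f) u q = a f q) ∧
        (∀ (f : StokesFE.Face) (q : StokesFE.faceVecP f ((r : ℤ) - 2)),
          StokesFE.tangentialMoment K f (n f) u q = b f q) ∧
        (∀ q : StokesFE.vecP ((r : ℤ) - 3), StokesFE.interiorMoment K u q = d q)) ∧
    -- the dimension is the number of degrees of freedom
    Module.finrank ℝ (K.S2plus r) =
      ∑ f : StokesFE.Face, Module.finrank ℝ (StokesFE.faceP f ((r : ℤ) - 1)) +
        ∑ f : StokesFE.Face, Module.finrank ℝ (StokesFE.faceVecP f ((r : ℤ) - 2)) +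
        Module.finrank ℝ (StokesFE.vecP ((r : ℤ) - 3)) ∧
    (Module.finrank ℝ (K.S2plus r) : ℝ) =
      (r : ℝ) * ((r : ℝ) ^ 2 + 3 * r + 8) / 2 + 6 * r * ((r : ℝ) - 1) ∧
    (r = 2 → Module.finrank ℝ (K.S2plus r) = 30) := by
  have hinj := K.dof_param_injective r hr n hn
  have hpinj : Function.Injective (K.param r) := by
    rw [LinearMap.coe_comp] at hinj
    exact hinj.of_comp
  have hN : ∀ f : StokesFE.Face,
      Module.finrank ℝ (StokesFE.faceP f ((r : ℤ) - 1)) = (r + 1).choose 2 := fun f => by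
    rw [← StokesFE.finrank_faceP f (r + 1), show ((r + 1 : ℕ) : ℤ) - 2 = (r : ℤ) - 1 by
      push_cast; ring]
  have hT := fun f : StokesFE.Face => StokesFE.finrank_faceVecP f r
  have hI := StokesFE.finrank_vecP r
  have hP : Module.finrank ℝ (StokesFE.vecP ((r : ℤ) - 1)) = 3 * (r + 2).choose 3 := by
    rw [← StokesFE.finrank_vecP (r + 2), show ((r + 2 : ℕ) : ℤ) - 3 = (r : ℤ) - 1 by
      push_cast; ring]
  have hW : Module.finrank ℝ (StokesFE.supplement ((r : ℤ) - 1)) = 3 * r := by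
    obtain ⟨k, rfl⟩ : ∃ k, r = k + 1 := ⟨r - 1, by omega⟩
    rw [show ((k + 1 : ℕ) : ℤ) - 1 = k by push_cast; ring, StokesFE.finrank_supplement]
  have hV : ∑ _f : StokesFE.Face, 2 * r.choose 2 ≤
      ∑ f : StokesFE.Face, Module.finrank ℝ (K.faceV ((r : ℤ) - 2) f) :=
    Finset.sum_le_sum fun f _ => K.le_finrank_faceV r f
  have hcard : Fintype.card StokesFE.Face = 6 := rfl
  have h1 := StokesFE.six_mul_choose_three r
  have h2 := StokesFE.six_mul_choose_three (r + 2)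
  have h3 : ((r + 1).choose 2 : ℝ) = ((r : ℝ) + 1) * r / 2 := by
    rw [Nat.cast_choose_two]; push_cast; ring
  have h4 := Nat.cast_choose_two ℝ r
  push_cast at h2
  -- `dim [P_{r-1}]³ + 3r` is the number of normal and interior moments
  have hserendipity : 3 * (r + 2).choose 3 + 3 * r =
      6 * (r + 1).choose 2 + 3 * r.choose 3 := by
    have : (3 * ((r + 2).choose 3 : ℝ) + 3 * r) =
        6 * ((r + 1).choose 2 : ℝ) + 3 * (r.choose 3 : ℝ) := by
      rw [h3]; linear_combination h2 / 2 - h1 / 2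
    exact_mod_cast this
  have hX : Module.finrank ℝ (StokesFE.vecP ((r : ℤ) - 1) ×
      StokesFE.supplement ((r : ℤ) - 1) × (∀ f, K.faceV ((r : ℤ) - 2) f)) =
      3 * (r + 2).choose 3 +
        (3 * r + ∑ f : StokesFE.Face, Module.finrank ℝ (K.faceV ((r : ℤ) - 2) f)) := by
    rw [Module.finrank_prod, Module.finrank_prod, Module.finrank_pi_fintype, hP, hW]
  have hY : Module.finrank ℝ
      ((∀ f : StokesFE.Face, Module.Dual ℝ (StokesFE.faceP f ((r : ℤ) - 1))) ×
        (∀ f : StokesFE.Face, Module.Dual ℝ (StokesFE.faceVecP f ((r : ℤ) - 2))) ×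
        Module.Dual ℝ (StokesFE.vecP ((r : ℤ) - 3))) =
      ∑ f : StokesFE.Face, Module.finrank ℝ (StokesFE.faceP f ((r : ℤ) - 1)) +
        ∑ f : StokesFE.Face, Module.finrank ℝ (StokesFE.faceVecP f ((r : ℤ) - 2)) +
        Module.finrank ℝ (StokesFE.vecP ((r : ℤ) - 3)) := by
    rw [Module.finrank_prod, Module.finrank_prod, Module.finrank_pi_fintype,
      Module.finrank_pi_fintype, Subspace.dual_finrank_eq, add_assoc]
    simp only [Subspace.dual_finrank_eq]
  have hcount : ∑ f : StokesFE.Face, Module.finrank ℝ (StokesFE.faceP f ((r : ℤ) - 1)) +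
        ∑ f : StokesFE.Face, Module.finrank ℝ (StokesFE.faceVecP f ((r : ℤ) - 2)) +
        Module.finrank ℝ (StokesFE.vecP ((r : ℤ) - 3)) =
      6 * (r + 1).choose 2 + 6 * (2 * r.choose 2) + 3 * r.choose 3 := by
    simp only [hN, hT, hI, Finset.sum_const, Finset.card_univ, hcard, smul_eq_mul]
  -- injectivity bounds the parameter count from above, the estimate of `dim V_f` from below
  have hXY := le_antisymm (LinearMap.finrank_le_finrank_of_injective hinj) (by
    rw [hX, hY, hcount]
    simp only [Finset.sum_const, Finset.card_univ, hcard, smul_eq_mul] at hV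
    omega)
  have hsurj := (LinearMap.injective_iff_surjective_of_finrank_eq_finrank hXY).1 hinj
  have hdim : Module.finrank ℝ (K.S2plus r) =
      ∑ f : StokesFE.Face, Module.finrank ℝ (StokesFE.faceP f ((r : ℤ) - 1)) +
        ∑ f : StokesFE.Face, Module.finrank ℝ (StokesFE.faceVecP f ((r : ℤ) - 2)) +
        Module.finrank ℝ (StokesFE.vecP ((r : ℤ) - 3)) := by
    rw [← K.range_param r, LinearMap.finrank_range_of_inj hpinj, hXY, hY]
  have hformula : (Module.finrank ℝ (K.S2plus r) : ℝ) =
      (r : ℝ) * ((r : ℝ) ^ 2 + 3 * r + 8) / 2 + 6 * r * ((r : ℝ) - 1) := by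
    rw [hdim, hcount]
    push_cast
    rw [h3, h4]
    linear_combination h1 / 2
  refine ⟨?_, ?_, hdim, hformula, ?_⟩
  · rw [Submodule.disjoint_def]
    intro u hs hv
    obtain ⟨p, w, rfl⟩ := StokesFE.Cube.mem_S2.1 hs
    obtain ⟨q, hq⟩ := StokesFE.Cube.mem_bubbleU.1 hv
    have h0 : K.param r (p, w, -q) = 0 := by
      rw [K.param_apply, hq, ← Finset.sum_add_distrib]
      simp
    have h := hpinj (h0.trans (map_zero _).symm)
    have hp : p = 0 := congrArg Prod.fst h
    have hw : w = 0 := congrArg (fun x => x.2.1) h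
    simp [hp, hw]
  · intro a b d
    obtain ⟨x, hx⟩ := hsurj (a, b, d)
    refine ⟨K.param r x, ⟨?_, (K.dof_eq_iff r n _ a b d).1 hx⟩, ?_⟩
    · rw [← K.range_param r]; exact LinearMap.mem_range_self _ x
    · rintro u ⟨hu, hmom⟩
      rw [← K.range_param r] at hu
      obtain ⟨y, rfl⟩ := hu
      exact congrArg _ (hinj (((K.dof_eq_iff r n _ a b d).2 hmom).trans hx.symm))
  · rintro rfl
    have h : (Module.finrank ℝ (K.S2plus 2) : ℝ) = (30 : ℕ) := by
      rw [hformula]; norm_num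
    exact_mod_cast h
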